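/- **Setting.** Let $w\in\mathbb R^n$ with $w_b>0$, $\sum_b w_b=1$, and $R_B>0$. For $R\ge 0$ let $\mathcal L(R)$ be the set of probability distributions $F$ on $\mathbb R_+^n$ with $\mathbb E_{x\sim F}\big[\sum_b x_b\big]\le R$, and for $P\ge0$ let $\Delta_n(P)=\{p\in\mathbb R_+^n:\sum_b p_b=P\}$. For $p\in\mathbb R^n_+$ and independent $x_A\sim F_A$, $x_B\sim F_B$, player $A$'s payoff is $$U_A(p,F_A,F_B)=\mathbb E\Big[\sum_b w_b\big(\mathbb 1\{x_{A,b}+p_b>x_{B,b}\}+\tau_b\mathbb 1\{x_{A,b}+p_b=x_{B,b}\}\big)\Big],\qquad U_B=1-U_A,$$ where $\tau\in[0,1]^n$ is an arbitrary tie-breaking rule ($\tau_b=1$: ties go to $A$; $\tau_b=0$: ties go to $B$). $\text{GL-F}(p,R_A,R_B)$ is the game in which $A$ and $B$ simultaneously choose $F_A\in\mathcal L(R_A)$, $F_B\in\mathcal L(R_B)$ with these payoffs. In the two-stage game $\text{GL-P}(P,R_A,R_B,w)$ player $A$ first chooses $p\in\Delta_n(P)$, which $B$ observes, and then $\text{GL-F}(p,R_A,R_B)$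 is played. A subgame-perfect equilibrium (SPE) is a triple $(p^*,F_A^*(\cdot),F_B^*(\cdot))$ with $p^*\in\Delta_n(P)$ such that $(F_A^*(p),F_B^*(p))$ is a Nash equilibrium of $\text{GL-F}(p,R_A,R_B)$ for every $p\in\Delta_n(P)$, and $U_A(p^*,F_A^*(p^*),F_B^*(p^*))\ge U_A(p,F_A^*(p),F_B^*(p))$ for every $p\in\Delta_n(P)$. **Theorem.** **(I) Second stage.** Let $R_A>0$ and $p\in\mathbb R_+^n$ be arbitrary. For $\kappa_A,\kappa_B>0$ put $\alpha_b=w_b\kappa_A$, $\beta_b=w_b\kappa_B$, $\mathcal B_1=\{b:0<\beta_b-p_b\le\alpha_b\}$, $\mathcal B_2=\{b:\beta_b-p_b>\alpha_b\}$. There exist $\kappa_A,\kappa_B>0$ with $$R_A=\sum_{b\in\mathcal B_1}\frac{(\beta_b-p_b)^2}{2\beta_b}+\sum_{b\in\mathcal B_2}\frac{\alpha_b^2}{2\beta_b},\qquad R_B=\sum_{b\in\mathcal B_1}\frac{\beta_b^2-p_b^2}{2\alpha_b}+\sum_{b\in\mathcal B_2}\frac{(\alpha_b+p_b)^2-p_b^2}{2\alpha_b}.\tag{1}$$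 For every such pair: (a) With $W_j=\sum_{\mathcal B_j}w_b$, $N=\sum_{\mathcal B_1}p_b^2/w_b$, $C_1=R_A+\sum_{\mathcal B_1}p_b$, $C_2=R_B-\sum_{\mathcal B_2}p_b$, $H_1=C_1^2-W_1N$, $H_2=C_2^2+W_2N$, $$\kappa_A=\frac{C_2H_1+C_1\sqrt{H_1H_2}}{W_1C_2^2+W_2C_1^2},\qquad \kappa_B=\frac{C_1H_2+C_2\sqrt{H_1H_2}}{W_1C_2^2+W_2C_1^2}.$$ (b) There are distributions $F_A$ and $F_B$ with the following univariate marginal distribution functions ($t\ge0$; they vanish for $t<0$): $$F_{A,b}(t)=\begin{cases}\min\{1,(t+p_b)/\beta_b\}& b\in\mathcal B_1\\ \min\{1,1-(\alpha_b-t)/\beta_b\}& b\in\mathcal B_2\\ 1&\text{otherwise,}\end{cases}$$ $$F_{B,b}(t)=\begin{cases}1-(\beta_b-p_b)/\alpha_b& b\in\mathcal B_1,\ t<p_b\\ \min\{1,1-(\beta_b-t)/\alpha_b\}& b\in\mathcal B_1,\ t\ge p_b\\ 0& b\in\mathcal B_2,\ t<p_b\\ \min\{1,(t-p_b)/\alpha_b\}&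 b\in\mathcal B_2,\ t\ge p_b\\ 1&\text{otherwise.}\end{cases}$$ Every pair $(F_A,F_B)$ with these marginals is a Nash equilibrium of $\text{GL-F}(p,R_A,R_B)$. (c) In every Nash equilibrium of $\text{GL-F}(p,R_A,R_B)$ player $A$'s payoff is $$\sum_{b\in\mathcal B_1}w_b\Big(1-\frac{\beta_b^2-p_b^2}{2\alpha_b\beta_b}\Big)+\sum_{b\in\mathcal B_2}w_b\frac{\alpha_b}{2\beta_b}+\sum_{b\notin\mathcal B_1\cup\mathcal B_2}w_b .$$ **(II) Two-stage game.** Let $P\ge0$, $R_A\ge0$, and define $\pi_A^*=\pi_A^*(P,R_A,R_B)$ as follows. 1. If $R_A>0$ and either $R_B\le P$, or $R_B>P$ and $R_A\ge\frac{2(R_B-P)^2}{P+2(R_B-P)}$, then $$\pi_A^*=1-\frac{R_B}{2R_A}\left(\frac{R_A+\sqrt{R_A(R_A+2P)}}{P+R_A+\sqrt{R_A(R_A+2P)}}\right)^2 .$$ 2. If $R_B>P$ and $0<R_A<\frac{2(R_B-P)^2}{P+2(R_B-P)}$, then $\pi_A^*=\frac{R_A}{2(R_B-P)}$. 3. If $R_A=0$,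 then $\pi_A^*=1-\min\{1,R_B/P\}$ (which is $0$ for $P=0$). Let $p^*=P\,w$. Then: (a) If $R_A>0$, or $R_A=0$ and ($P<R_B$ or all ties go to $B$), then there is an SPE with pre-allocation $p^*$. (b) If $(F_A^*(p),F_B^*(p))$ is a Nash equilibrium of $\text{GL-F}(p,R_A,R_B)$ for each $p\in\Delta_n(P)$, then $(p^*,F_A^*,F_B^*)$ is an SPE. (c) In every SPE the payoffs of $A$ and $B$ are $\pi_A^*$ and $1-\pi_A^*$. (d) Some $F_A\in\mathcal L(R_A)$ satisfies $U_A(p^*,F_A,F_B)\ge\pi_A^*$ for all $F_B\in\mathcal L(R_B)$; and for every $p\in\Delta_n(P)$ and $\varepsilon>0$ some $F_B\in\mathcal L(R_B)$ satisfies $U_A(p,F_A,F_B)\le\pi_A^*+\varepsilon$ for all $F_A\in\mathcal L(R_A)$. In particular, for $P=0$ and $R_A>0$, $\pi_A^*=\frac{R_A}{2R_B}$ if $R_A<R_B$ and $\pi_A^*=1-\frac{R_B}{2R_A}$ otherwise. -/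

import Mathlib

open MeasureTheory ProbabilityTheory

noncomputable section

namespace Lotto

variable {n : ℕ}

/-- `Δ_n(P)`: nonnegative vectors whose entries sum to `P`. -/
def preallocations (n : ℕ) (P : ℝ) : Set (Fin n → ℝ) :=
  {p | (∀ b, 0 ≤ p b) ∧ ∑ b, p b = P}

/-- `𝓛(R)`: probability distributions on `ℝ₊ⁿ` whose expected total allocation is at most `R`. -/
structure IsStrategy (R : ℝ) (F : Measure (Fin n → ℝ)) : Prop where
  isProbabilityMeasure : IsProbabilityMeasure F
  nonneg : ∀ᵐ x ∂F, ∀ b, 0 ≤ x b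
  budget : ∫⁻ x, ENNReal.ofReal (∑ b, x b) ∂F ≤ ENNReal.ofReal R

/-- The share of a battlefield won by `A`, who holds `a` there (pre-allocated plus real-time
resources) against `x` resources of `B`; `t` is the share of `A` at a tie. The winner indicator
`𝟙{a ≥ x}` is the case `t = 1`. -/
def winShare (t a x : ℝ) : ℝ :=
  if x < a then 1 else if x = a then t else 0

/-- Expected payoff of player `A` (the two allocations are drawn independently). -/
def payoffA (w τ p : Fin n → ℝ) (FA FB : Measure (Fin n → ℝ)) : ℝ :=
  ∫ z, ∑ b, w b * winShare (τ b) (z.1 b + p b) (z.2 b) ∂(FA.prod FB)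

/-- Expected payoff of player `B`. -/
def payoffB (w τ p : Fin n → ℝ) (FA FB : Measure (Fin n → ℝ)) : ℝ :=
  1 - payoffA w τ p FA FB

/-- Nash equilibrium of the General Lotto game with favoritism `GL-F(p, R_A, R_B)`. -/
structure IsNash (w τ p : Fin n → ℝ) (RA RB : ℝ) (FA FB : Measure (Fin n → ℝ)) : Prop where
  strategyA : IsStrategy RA FA
  strategyB : IsStrategy RB FB
  optimalA : ∀ GA, IsStrategy RA GA → payoffA w τ p GA FB ≤ payoffA w τ p FA FB
  optimalB : ∀ GB, IsStrategy RB GB → payoffB w τ p FA GB ≤ payoffB w τ p FA FB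

/-- Subgame-perfect equilibrium of the two-stage game `GL-P(P, R_A, R_B, w)`. -/
structure IsSPE (w τ : Fin n → ℝ) (P RA RB : ℝ) (pstar : Fin n → ℝ)
    (FA FB : (Fin n → ℝ) → Measure (Fin n → ℝ)) : Prop where
  feasible : pstar ∈ preallocations n P
  nash : ∀ p ∈ preallocations n P, IsNash w τ p RA RB (FA p) (FB p)
  optimal : ∀ p ∈ preallocations n P,
    payoffA w τ p (FA p) (FB p) ≤ payoffA w τ pstar (FA pstar) (FB pstar)

/-- Player `A`'s closed-form payoff in the two-stage game: the cases `R_A = 0`,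
`R_B ≤ P` or `R_A ≥ 2(R_B-P)²/(P+2(R_B-P))`, and the remaining one. For `P > 0` the first value
is `1 - min {1, R_B/P}`. -/
def spePayoff (P RA RB : ℝ) : ℝ :=
  if RA = 0 then
    if P ≤ RB then 0 else 1 - RB / P
  else if RB ≤ P ∨ 2 * (RB - P) ^ 2 / (P + 2 * (RB - P)) ≤ RA then
    1 - RB / (2 * RA) *
      ((RA + √(RA * (RA + 2 * P))) / (P + RA + √(RA * (RA + 2 * P)))) ^ 2
  else RA / (2 * (RB - P))

/-! In the definitions below `α = w_b κ_A`, `β = w_b κ_B` and `p = p_b` on one battlefield. It is of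
type 1 if `0 < β - p ≤ α`, of type 2 if `β - p > α`, and uncontested if `β ≤ p`. -/

/-- Cumulative distribution function of `A`'s equilibrium allocation to one battlefield. -/
def marginalA (α β p t : ℝ) : ℝ :=
  if t < 0 then 0
  else if β ≤ p then 1
  else if β - p ≤ α then min 1 ((t + p) / β)
  else min 1 (1 - (α - t) / β)

/-- Cumulative distribution function of `B`'s equilibrium allocation to one battlefield. -/
def marginalB (α β p t : ℝ) : ℝ :=
  if t < 0 then 0
  else if β ≤ p then 1
  else if β - p ≤ α then
    if t < p then 1 - (β - p) / α else min 1 (1 - (β - t) / α)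
  else if t < p then 0 else min 1 ((t - p) / α)

/-- Expected expenditure of `A` on one battlefield. -/
def spendA (α β p : ℝ) : ℝ :=
  if β ≤ p then 0
  else if β - p ≤ α then (β - p) ^ 2 / (2 * β)
  else α ^ 2 / (2 * β)

/-- Expected expenditure of `B` on one battlefield. -/
def spendB (α β p : ℝ) : ℝ :=
  if β ≤ p then 0
  else if β - p ≤ α then (β ^ 2 - p ^ 2) / (2 * α)
  else ((α + p) ^ 2 - p ^ 2) / (2 * α)

/-- Probability that `A` wins one battlefield. -/
def winProbA (α β p : ℝ) : ℝ :=
  if β ≤ p then 1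
  else if β - p ≤ α then 1 - (β ^ 2 - p ^ 2) / (2 * α * β)
  else α / (2 * β)

/-- The system of equations for the positive pair `(κ_A, κ_B)`: both budgets are spent. -/
structure IsKappa (w p : Fin n → ℝ) (RA RB κA κB : ℝ) : Prop where
  posA : 0 < κA
  posB : 0 < κB
  eqA : ∑ b, spendA (w b * κA) (w b * κB) (p b) = RA
  eqB : ∑ b, spendB (w b * κA) (w b * κB) (p b) = RB

/-- `F` is a distribution on `ℝⁿ` with prescribed univariate marginal distribution functions. -/
structure HasMarginals (F : Measure (Fin n → ℝ)) (G : Fin n → ℝ → ℝ) : Prop where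
  isProbabilityMeasure : IsProbabilityMeasure F
  cdf_eq : ∀ b t, cdf (F.map (fun x => x b)) t = G b t

open scoped Classical in
/-- The battlefields of type 1. -/
def type1 (w p : Fin n → ℝ) (κA κB : ℝ) : Finset (Fin n) :=
  Finset.univ.filter fun b => 0 < w b * κB - p b ∧ w b * κB - p b ≤ w b * κA

open scoped Classical in
/-- The battlefields of type 2. -/
def type2 (w p : Fin n → ℝ) (κA κB : ℝ) : Finset (Fin n) :=
  Finset.univ.filter fun b => w b * κA < w b * κB - p b

/-- `C₁ = R_A + P₁`, where `P₁` is the total pre-allocation to `B₁`. -/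
def cOne (p : Fin n → ℝ) (RA : ℝ) (B₁ : Finset (Fin n)) : ℝ := RA + ∑ b ∈ B₁, p b

/-- `C₂ = R_B - P₂`, where `P₂` is the total pre-allocation to `B₂`. -/
def cTwo (p : Fin n → ℝ) (RB : ℝ) (B₂ : Finset (Fin n)) : ℝ := RB - ∑ b ∈ B₂, p b

/-- `H₁ = C₁² - W₁ N₁`, where `W₁ = ∑_{B₁} w_b` and `N₁ = ∑_{B₁} p_b²/w_b`. -/
def hOne (w p : Fin n → ℝ) (RA : ℝ) (B₁ : Finset (Fin n)) : ℝ :=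
  cOne p RA B₁ ^ 2 - (∑ b ∈ B₁, w b) * ∑ b ∈ B₁, p b ^ 2 / w b

/-- `H₂ = C₂² + W₂ N₁`, where `W₂ = ∑_{B₂} w_b` and `N₁ = ∑_{B₁} p_b²/w_b`. -/
def hTwo (w p : Fin n → ℝ) (RB : ℝ) (B₁ B₂ : Finset (Fin n)) : ℝ :=
  cTwo p RB B₂ ^ 2 + (∑ b ∈ B₂, w b) * ∑ b ∈ B₁, p b ^ 2 / w b

/-- `W₁ C₂² + W₂ C₁²`. -/
def kappaDenom (w p : Fin n → ℝ) (RA RB : ℝ) (B₁ B₂ : Finset (Fin n)) : ℝ :=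
  (∑ b ∈ B₁, w b) * cTwo p RB B₂ ^ 2 + (∑ b ∈ B₂, w b) * cOne p RA B₁ ^ 2

/-- Closed form of `κ_A` when `B₁`, `B₂` are the battlefields of types 1 and 2. -/
def kappaA (w p : Fin n → ℝ) (RA RB : ℝ) (B₁ B₂ : Finset (Fin n)) : ℝ :=
  (cTwo p RB B₂ * hOne w p RA B₁ + cOne p RA B₁ * √(hOne w p RA B₁ * hTwo w p RB B₁ B₂)) /
    kappaDenom w p RA RB B₁ B₂

/-- Closed form of `κ_B` when `B₁`, `B₂` are the battlefields of types 1 and 2. -/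
def kappaB (w p : Fin n → ℝ) (RA RB : ℝ) (B₁ B₂ : Finset (Fin n)) : ℝ :=
  (cOne p RA B₁ * hTwo w p RB B₁ B₂ + cTwo p RB B₂ * √(hOne w p RA B₁ * hTwo w p RB B₁ B₂)) /
    kappaDenom w p RA RB B₁ B₂

end Lotto

end

noncomputable section

namespace Lotto

variable {n : ℕ}

/-! ### Shares and payoffs -/

/-! Both stages rest on zero-sum certificates. If the probability that `A` beats an allocation `y`
on battlefield `b`, times `w b`, is bounded below by an affine function of `y` whose slope `-μ` is
the same on all battlefields, then only the expected total spending of `B` matters, and `A` has a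
guarantee (`le_payoffA`). Dually, `payoffA_le` turns affine bounds on the marginals of `B` into a
cap on the payoff of `A`.

Second stage. With `m = min (max 0 (β - p)) α` (`contested`), the three battlefield types merge: `A`
spreads mass with density `1 / β` over `[0, m]`, `B` with density `1 / α` over `[p, p + m]`, and the
rest sits at `0`. These laws satisfy affine bounds with slopes `1 / κB` and `1 / κA`, so the `κ`'s
are reciprocal budget prices. The system `IsKappa` says that both budgets are exhausted; then
guarantee and cap coincide (`value_le_payoffA`, `payoffA_le_value`), which gives equilibrium and a
unique value. The system is solved by two nested applications of the intermediate value theorem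
(`exists_relative_solution`).

First stage. At `P w` all battlefields are scaled copies of one, and the value reduces to the closed
form (`spePayoff_eq`). To see that no `p` is better, values at different `p` need not be compared:
`B` shifts the same ramps to start at `p b`, with a common contesting probability `r`. Both the cost
`r (P + κ r / 2)` and the resulting cap depend on `p` only through `P` (`exists_strategyB`). With
`r` and `κ` taken from the solution at `P w`, the cap equals the value there. The case `RA = 0` is
treated separately, up to `ε`. -/

lemma winShare_le {t a x : ℝ} (ht : t ≤ 1) : winShare t a x ≤ if x ≤ a then 1 else 0 := by
  unfold winShare
  split_ifs <;> linarith

/-- With `winShare_le` this sandwiches the share between strict and weak victory. Guarantees for `A`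
use only strict victories and caps by `B` concede all ties, so values do not depend on `τ`. -/
lemma le_winShare {t a x : ℝ} (ht : 0 ≤ t) : (if x < a then 1 else 0) ≤ winShare t a x := by
  unfold winShare
  split_ifs <;> linarith

lemma winShare_nonneg {t a x : ℝ} (ht : 0 ≤ t) : 0 ≤ winShare t a x := by
  unfold winShare
  split_ifs <;> linarith

lemma winShare_le_one {t a x : ℝ} (ht : t ≤ 1) : winShare t a x ≤ 1 := by
  unfold winShare
  split_ifs <;> linarith

lemma measurable_winShare {Ω : Type*} [MeasurableSpace Ω] (t : ℝ) {f g : Ω → ℝ}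
    (hf : Measurable f) (hg : Measurable g) : Measurable fun z => winShare t (f z) (g z) := by
  unfold winShare
  exact Measurable.ite (measurableSet_lt hg hf) measurable_const
    (Measurable.ite (measurableSet_eq_fun hg hf) measurable_const measurable_const)

lemma measurable_share (w τ p : Fin n → ℝ) :
    Measurable fun z : (Fin n → ℝ) × (Fin n → ℝ) =>
      ∑ b, w b * winShare (τ b) (z.1 b + p b) (z.2 b) := by
  refine Finset.measurable_sum _ fun b _ => (measurable_winShare _ ?_ ?_).const_mul _ <;> fun_prop

lemma integrable_share {w τ : Fin n → ℝ} (p : Fin n → ℝ) (hw : ∀ b, 0 < w b)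
    (hτ : ∀ b, 0 ≤ τ b ∧ τ b ≤ 1) {Ω : Type*} [MeasurableSpace Ω] (μ : Measure Ω)
    [IsFiniteMeasure μ] {f g : Ω → Fin n → ℝ} (hf : Measurable f) (hg : Measurable g) :
    Integrable (fun z => ∑ b, w b * winShare (τ b) (f z b + p b) (g z b)) μ := by
  refine Integrable.of_bound (C := ∑ b, w b)
    ((measurable_share w τ p).comp (hf.prodMk hg)).aestronglyMeasurable ?_
  refine Filter.Eventually.of_forall fun z => ?_
  rw [Real.norm_eq_abs, abs_of_nonneg
    (Finset.sum_nonneg fun b _ => mul_nonneg (hw b).le (winShare_nonneg (hτ b).1))]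
  refine Finset.sum_le_sum fun b _ => ?_
  simpa using mul_le_mul_of_nonneg_left (winShare_le_one (hτ b).2) (hw b).le

lemma IsStrategy.integrable {R : ℝ} {F : Measure (Fin n → ℝ)} (h : IsStrategy R F) :
    Integrable (fun x => ∑ b, x b) F := by
  have hm : Measurable fun x : Fin n → ℝ => ∑ b, x b := by fun_prop
  refine ⟨hm.aestronglyMeasurable, ?_⟩
  rw [hasFiniteIntegral_iff_ofReal]
  · exact h.budget.trans_lt ENNReal.ofReal_lt_top
  · filter_upwards [h.nonneg] with x hx using Finset.sum_nonneg fun b _ => hx b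

lemma IsStrategy.integral_le {R : ℝ} (hR : 0 ≤ R) {F : Measure (Fin n → ℝ)}
    (h : IsStrategy R F) : ∫ x, ∑ b, x b ∂F ≤ R := by
  have hm : Measurable fun x : Fin n → ℝ => ∑ b, x b := by fun_prop
  rw [integral_eq_lintegral_of_nonneg_ae _ hm.aestronglyMeasurable]
  · exact ENNReal.toReal_le_of_le_ofReal hR h.budget
  · filter_upwards [h.nonneg] with x hx using Finset.sum_nonneg fun b _ => hx b

lemma measurable_coord (p : Fin n → ℝ) (b : Fin n) : Measurable fun x : Fin n → ℝ => x b + p b := by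
  fun_prop

/-- An affine lower bound on the winning probabilities of `FA` bounds the payoff of `A` below. -/
lemma le_payoffA {w τ p c : Fin n → ℝ} {μ RB : ℝ} (hw : ∀ b, 0 < w b)
    (hτ : ∀ b, 0 ≤ τ b ∧ τ b ≤ 1) (hμ : 0 ≤ μ) (hRB : 0 ≤ RB) {FA FB : Measure (Fin n → ℝ)}
    [IsProbabilityMeasure FA] (hFB : IsStrategy RB FB)
    (h : ∀ b y, 0 ≤ y → w b * c b - μ * y ≤ w b * FA.real {x | y < x b + p b}) :
    ∑ b, w b * c b - μ * RB ≤ payoffA w τ p FA FB := by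
  have := hFB.isProbabilityMeasure
  unfold payoffA
  have hint := integrable_share p hw hτ (FA.prod FB) measurable_fst measurable_snd
  rw [integral_prod_symm _ hint]
  calc ∑ b, w b * c b - μ * RB ≤ ∑ b, w b * c b - μ * ∫ y, ∑ b, y b ∂FB := by
        have := mul_le_mul_of_nonneg_left (hFB.integral_le hRB) hμ
        linarith
    _ = ∫ y, (∑ b, w b * c b - μ * ∑ b, y b) ∂FB := by
        rw [integral_sub (integrable_const _) (hFB.integrable.const_mul _), integral_const_mul]
        simp
    _ ≤ _ := by
        refine integral_mono_ae ((integrable_const _).sub (hFB.integrable.const_mul _))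
          hint.integral_prod_right ?_
        filter_upwards [hFB.nonneg] with y hy
        calc ∑ b, w b * c b - μ * ∑ b, y b = ∑ b, (w b * c b - μ * y b) := by
              rw [Finset.sum_sub_distrib, Finset.mul_sum]
          _ ≤ ∑ b, w b * FA.real {x | y b < x b + p b} :=
              Finset.sum_le_sum fun b _ => h b _ (hy b)
          _ = ∫ x, ∑ b, w b * (if y b < x b + p b then 1 else 0) ∂FA := by
              have hms : ∀ b, MeasurableSet {x : Fin n → ℝ | y b < x b + p b} := fun b =>
                measurableSet_lt measurable_const (measurable_coord p b)
              have he : ∀ b, (fun x : Fin n → ℝ => if y b < x b + p b then (1 : ℝ) else 0) =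
                  Set.indicator {x | y b < x b + p b} 1 := fun b => by
                ext x; simp [Set.indicator_apply]
              rw [integral_finsetSum]
              · refine Finset.sum_congr rfl fun b _ => ?_
                rw [integral_const_mul, he, integral_indicator_one (hms b)]
              · intro b _
                have hi : Integrable (fun x => if y b < x b + p b then (1 : ℝ) else 0) FA := by
                  rw [he]
                  exact (integrable_const (1 : ℝ)).indicator (hms b)
                exact hi.const_mul _
          _ ≤ _ := by
              refine integral_mono_of_nonneg ?_ ?_ ?_
              · refine Filter.Eventually.of_forall fun x => ?_
                exact Finset.sum_nonneg fun b _ => mul_nonneg (hw b).le (by split_ifs <;> simp)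
              · exact integrable_share p hw hτ FA measurable_id measurable_const
              · exact Filter.Eventually.of_forall fun x => Finset.sum_le_sum fun b _ =>
                  mul_le_mul_of_nonneg_left (le_winShare (hτ b).1) (hw b).le

/-- An affine upper bound on the losing probabilities of `FB` bounds the payoff of `A` above. -/
lemma payoffA_le {w τ p d : Fin n → ℝ} {l RA : ℝ} (hw : ∀ b, 0 < w b)
    (hτ : ∀ b, 0 ≤ τ b ∧ τ b ≤ 1) (hl : 0 ≤ l) (hRA : 0 ≤ RA) {FA FB : Measure (Fin n → ℝ)}
    [IsProbabilityMeasure FB] (hFA : IsStrategy RA FA)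
    (h : ∀ b x, 0 ≤ x → w b * FB.real {y | y b ≤ x + p b} ≤ w b * d b + l * x) :
    payoffA w τ p FA FB ≤ ∑ b, w b * d b + l * RA := by
  have := hFA.isProbabilityMeasure
  unfold payoffA
  have hint := integrable_share p hw hτ (FA.prod FB) measurable_fst measurable_snd
  rw [integral_prod _ hint]
  calc _ ≤ ∫ x, (∑ b, w b * d b + l * ∑ b, x b) ∂FA := by
        refine integral_mono_ae hint.integral_prod_left
          ((integrable_const _).add (hFA.integrable.const_mul _)) ?_
        filter_upwards [hFA.nonneg] with x hx
        have hms : ∀ b, MeasurableSet {y : Fin n → ℝ | y b ≤ x b + p b} := fun b =>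
          measurableSet_le (by fun_prop) measurable_const
        have he : ∀ b, (fun y : Fin n → ℝ => if y b ≤ x b + p b then (1 : ℝ) else 0) =
            Set.indicator {y | y b ≤ x b + p b} 1 := fun b => by
          ext y; simp [Set.indicator_apply]
        have hi : ∀ b, Integrable
            (fun y : Fin n → ℝ => w b * (if y b ≤ x b + p b then (1 : ℝ) else 0)) FB := by
          intro b
          have hi : Integrable (fun y => if y b ≤ x b + p b then (1 : ℝ) else 0) FB := by
            rw [he]
            exact (integrable_const (1 : ℝ)).indicator (hms b)
          exact hi.const_mul _
        calc _ ≤ ∫ y, ∑ b, w b * (if y b ≤ x b + p b then 1 else 0) ∂FB := by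
              refine integral_mono_of_nonneg ?_ ?_ ?_
              · exact Filter.Eventually.of_forall fun y => Finset.sum_nonneg fun b _ =>
                  mul_nonneg (hw b).le (winShare_nonneg (hτ b).1)
              · exact integrable_finsetSum _ fun b _ => hi b
              · exact Filter.Eventually.of_forall fun y => Finset.sum_le_sum fun b _ =>
                  mul_le_mul_of_nonneg_left (winShare_le (hτ b).2) (hw b).le
          _ = ∑ b, w b * FB.real {y | y b ≤ x b + p b} := by
              rw [integral_finsetSum _ fun b _ => hi b]
              refine Finset.sum_congr rfl fun b _ => ?_
              rw [integral_const_mul, he, integral_indicator_one (hms b)]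
          _ ≤ ∑ b, (w b * d b + l * x b) := Finset.sum_le_sum fun b _ => h b _ (hx b)
          _ = _ := by rw [Finset.sum_add_distrib, Finset.mul_sum]
    _ = ∑ b, w b * d b + l * ∫ x, ∑ b, x b ∂FA := by
        rw [integral_add (integrable_const _) (hFA.integrable.const_mul _), integral_const_mul]
        simp
    _ ≤ _ := by
        have := mul_le_mul_of_nonneg_left (hFA.integral_le hRA) hl
        linarith

/-! ### A family of distribution functions -/

/-- The distribution function of the law with an atom of mass `1 - c` at `0` and the remaining
mass spread with density `1 / γ` over `[p, p + c γ]`. -/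
def rampCdf (c p γ t : ℝ) : ℝ :=
  if t < 0 then 0 else 1 - max 0 (min c (c - (t - p) / γ))

lemma rampCdf_monotone {c p γ : ℝ} (hc : c ≤ 1) (hγ : 0 < γ) : Monotone (rampCdf c p γ) := by
  intro s t hst
  unfold rampCdf
  split_ifs with h1 h2 h2
  · exact le_rfl
  · have : max 0 (min c (c - (t - p) / γ)) ≤ 1 :=
      max_le zero_le_one ((min_le_left _ _).trans hc)
    linarith
  · exact absurd (hst.trans_lt h2) h1
  · gcongr

lemma rampCdf_rightContinuous (c p γ x : ℝ) :
    ContinuousWithinAt (rampCdf c p γ) (Set.Ici x) x := by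
  have hcont : Continuous fun t : ℝ => 1 - max 0 (min c (c - (t - p) / γ)) := by fun_prop
  rcases lt_or_ge x 0 with hx | hx
  · refine ContinuousAt.continuousWithinAt ?_
    refine (continuousAt_const (y := (0 : ℝ))).congr ?_
    filter_upwards [Iio_mem_nhds hx] with t ht
    simp [rampCdf, Set.mem_Iio.1 ht]
  · refine hcont.continuousWithinAt.congr (fun t ht => ?_) ?_
    · simp [rampCdf, not_lt.2 (hx.trans (Set.mem_Ici.1 ht))]
    · simp [rampCdf, not_lt.2 hx]

lemma exists_cdf_eq_rampCdf {c p γ : ℝ} (hc : c ≤ 1) (hγ : 0 < γ) :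
    ∃ μ : Measure ℝ, IsProbabilityMeasure μ ∧ ∀ t, cdf μ t = rampCdf c p γ t := by
  let f : StieltjesFunction ℝ :=
    ⟨rampCdf c p γ, rampCdf_monotone hc hγ, rampCdf_rightContinuous c p γ⟩
  have h0 : Filter.Tendsto f Filter.atBot (nhds 0) := by
    refine tendsto_const_nhds.congr' ?_
    filter_upwards [Filter.eventually_lt_atBot 0] with t ht
    change 0 = rampCdf c p γ t
    simp [rampCdf, ht]
  have h1 : Filter.Tendsto f Filter.atTop (nhds 1) := by
    refine tendsto_const_nhds.congr' ?_
    filter_upwards [Filter.eventually_ge_atTop 0, Filter.eventually_ge_atTop (p + c * γ)]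
      with t ht ht'
    change 1 = rampCdf c p γ t
    have : c - (t - p) / γ ≤ 0 := by
      rw [sub_nonpos, le_div_iff₀ hγ]; linarith
    rw [rampCdf, if_neg (not_lt.2 ht), max_eq_left ((min_le_right _ _).trans this), sub_zero]
  exact ⟨f.measure, f.isProbabilityMeasure h0 h1, fun t => by
    rw [cdf_measure_stieltjesFunction f h0 h1]⟩

/-- Independent coordinates are one coupling among many. Spending and the affine bounds are sums
over battlefields, so only the marginals ever matter. -/
lemma exists_marginals (μ : Fin n → Measure ℝ) (h : ∀ b, IsProbabilityMeasure (μ b)) :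
    ∃ F : Measure (Fin n → ℝ), IsProbabilityMeasure F ∧ ∀ b, F.map (fun x => x b) = μ b :=
  ⟨Measure.pi μ, inferInstance, fun b => (measurePreserving_eval μ b).map_eq⟩

lemma exists_hasMarginals_rampCdf {c p γ : Fin n → ℝ} (hc : ∀ b, c b ≤ 1) (hγ : ∀ b, 0 < γ b) :
    ∃ F, HasMarginals F fun b => rampCdf (c b) (p b) (γ b) := by
  choose μ hμ hcdf using fun b => exists_cdf_eq_rampCdf (p := p b) (hc b) (hγ b)
  obtain ⟨F, hF, hmap⟩ := exists_marginals μ hμ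
  exact ⟨F, hF, fun b t => by rw [hmap, hcdf]⟩

lemma HasMarginals.real_Iic {F : Measure (Fin n → ℝ)} {G : Fin n → ℝ → ℝ} (h : HasMarginals F G)
    (b : Fin n) (t : ℝ) : F.real {x | x b ≤ t} = G b t := by
  have := h.isProbabilityMeasure
  have hm : Measurable fun x : Fin n → ℝ => x b := by fun_prop
  have : IsProbabilityMeasure (F.map fun x => x b) := Measure.isProbabilityMeasure_map hm.aemeasurable
  rw [← h.cdf_eq b t, cdf_eq_real, map_measureReal_apply hm measurableSet_Iic]
  rfl

lemma HasMarginals.real_Ioi {F : Measure (Fin n → ℝ)} {G : Fin n → ℝ → ℝ} (h : HasMarginals F G)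
    (b : Fin n) (t : ℝ) : F.real {x | t < x b} = 1 - G b t := by
  have := h.isProbabilityMeasure
  have hm : MeasurableSet {x : Fin n → ℝ | x b ≤ t} :=
    measurableSet_le (by fun_prop) measurable_const
  rw [← h.real_Iic, ← probReal_compl_eq_one_sub hm]
  congr 1
  ext x
  simp

lemma HasMarginals.nonneg {F : Measure (Fin n → ℝ)} {G : Fin n → ℝ → ℝ} (h : HasMarginals F G)
    (hG : ∀ b t, t < 0 → G b t = 0) : ∀ᵐ x ∂F, ∀ b, 0 ≤ x b := by
  have := h.isProbabilityMeasure
  rw [ae_all_iff]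
  intro b
  -- The distribution function vanishes at each `-1 / (k + 1)`, and countably many such half-lines
  -- exhaust the negative axis.
  have hk : ∀ k : ℕ, ∀ᵐ x ∂F, -(1 / ((k : ℝ) + 1)) < x b := by
    intro k
    have hneg : -(1 / ((k : ℝ) + 1)) < 0 := neg_neg_of_pos (by positivity)
    have h0 : F.real {x | x b ≤ -(1 / ((k : ℝ) + 1))} = 0 := by
      rw [h.real_Iic, hG b _ hneg]
    rw [measureReal_eq_zero_iff] at h0
    rw [ae_iff]
    simpa only [not_lt] using h0
  filter_upwards [ae_all_iff.2 hk] with x hx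
  by_contra! hneg
  obtain ⟨k, hk⟩ := exists_nat_one_div_lt (neg_pos.2 hneg)
  have := hx k
  linarith

/-- The tail of the ramp law is a rectangle of height `c` over `(0, p]` followed by a triangle of
height `c` and base `c γ`; their areas give the mean by the layer-cake formula. -/
lemma lintegral_ramp {c p γ : ℝ} (hc : 0 ≤ c) (hp : 0 ≤ p) (hγ : 0 < γ) :
    ∫⁻ t in Set.Ioi (0 : ℝ), ENNReal.ofReal (max 0 (min c (c - (t - p) / γ))) =
      ENNReal.ofReal (c * p + c ^ 2 * γ / 2) := by
  have hcγ : 0 ≤ c * γ := by positivity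
  have hsplit : Set.Ioi (0 : ℝ) = (Set.Ioc 0 p ∪ Set.Ioc p (p + c * γ)) ∪ Set.Ioi (p + c * γ) := by
    rw [Set.Ioc_union_Ioc_eq_Ioc hp (by linarith), Set.Ioc_union_Ioi_eq_Ioi (by linarith)]
  have hd1 : Disjoint (Set.Ioc 0 p ∪ Set.Ioc p (p + c * γ)) (Set.Ioi (p + c * γ)) := by
    rw [Set.Ioc_union_Ioc_eq_Ioc hp (by linarith)]
    exact Set.disjoint_left.2 fun x hx hx' => absurd hx.2 (not_le.2 hx')
  have hd2 : Disjoint (Set.Ioc 0 p) (Set.Ioc p (p + c * γ)) :=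
    Set.disjoint_left.2 fun x hx hx' => absurd hx.2 (not_le.2 hx'.1)
  rw [hsplit, lintegral_union measurableSet_Ioi hd1, lintegral_union measurableSet_Ioc hd2]
  have e1 : ∫⁻ t in Set.Ioc 0 p, ENNReal.ofReal (max 0 (min c (c - (t - p) / γ))) =
      ENNReal.ofReal (c * p) := by
    rw [setLIntegral_congr_fun (g := fun _ => ENNReal.ofReal c) measurableSet_Ioc]
    · rw [setLIntegral_const, Real.volume_Ioc, sub_zero, ENNReal.ofReal_mul hc]
    · intro t ht
      have : (t - p) / γ ≤ 0 := div_nonpos_of_nonpos_of_nonneg (by linarith [ht.2]) hγ.le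
      simp only
      rw [min_eq_left (by linarith), max_eq_right hc]
  have e3 : ∫⁻ t in Set.Ioi (p + c * γ), ENNReal.ofReal (max 0 (min c (c - (t - p) / γ))) = 0 := by
    rw [setLIntegral_congr_fun (g := fun _ => 0) measurableSet_Ioi]
    · simp
    · intro t ht
      have : c ≤ (t - p) / γ := by rw [le_div_iff₀ hγ]; linarith [Set.mem_Ioi.1 ht]
      simp only
      rw [max_eq_left ((min_le_right _ _).trans (by linarith)), ENNReal.ofReal_zero]
  have e2 : ∫⁻ t in Set.Ioc p (p + c * γ), ENNReal.ofReal (max 0 (min c (c - (t - p) / γ))) =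
      ENNReal.ofReal (c ^ 2 * γ / 2) := by
    have hnn : ∀ t ∈ Set.Ioc p (p + c * γ), 0 ≤ c - (t - p) / γ := fun t ht => by
      rw [sub_nonneg, div_le_iff₀ hγ]; linarith [ht.2]
    rw [setLIntegral_congr_fun (g := fun t => ENNReal.ofReal (c - (t - p) / γ)) measurableSet_Ioc]
    · have hcont : Continuous fun t : ℝ => c - (t - p) / γ := by fun_prop
      rw [← ofReal_integral_eq_lintegral_ofReal]
      · rw [← intervalIntegral.integral_of_le (by linarith)]
        congr 1
        rw [intervalIntegral.integral_eq_sub_of_hasDerivAt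
          (f := fun t => c * t - (t - p) ^ 2 / (2 * γ)) _ (hcont.intervalIntegrable _ _)]
        · field_simp; ring
        · intro t _
          have h1 := ((hasDerivAt_id t).const_mul c).sub
            ((((hasDerivAt_id t).sub_const p).pow 2).div_const (2 * γ))
          refine HasDerivAt.congr_deriv h1 ?_
          simp
          field_simp
      · exact hcont.integrableOn_Ioc
      · exact (ae_restrict_iff' measurableSet_Ioc).2 (Filter.Eventually.of_forall hnn)
    · intro t ht
      have : 0 ≤ (t - p) / γ := div_nonneg (by linarith [ht.1]) hγ.le
      simp only
      rw [min_eq_right (by linarith), max_eq_right (hnn t ht)]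
  rw [e1, e2, e3, add_zero, ENNReal.ofReal_add (by positivity) (by positivity)]

lemma HasMarginals.lintegral_rampCdf {F : Measure (Fin n → ℝ)} {c p γ : Fin n → ℝ}
    (h : HasMarginals F fun b => rampCdf (c b) (p b) (γ b)) (hc : ∀ b, 0 ≤ c b)
    (hp : ∀ b, 0 ≤ p b) (hγ : ∀ b, 0 < γ b) (b : Fin n) :
    ∫⁻ x, ENNReal.ofReal (x b) ∂F = ENNReal.ofReal (c b * p b + c b ^ 2 * γ b / 2) := by
  have := h.isProbabilityMeasure
  have hnn := h.nonneg fun b t ht => by simp [rampCdf, ht]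
  rw [lintegral_eq_lintegral_meas_lt F (hnn.mono fun x hx => hx b)
    (by fun_prop : Measurable fun x : Fin n → ℝ => x b).aemeasurable,
    ← lintegral_ramp (hc b) (hp b) (hγ b)]
  refine setLIntegral_congr_fun measurableSet_Ioi fun t ht => ?_
  rw [← ofReal_measureReal, h.real_Ioi, rampCdf, if_neg (not_lt.2 (Set.mem_Ioi.1 ht).le),
    sub_sub_cancel]

lemma lintegral_sum_coord {F : Measure (Fin n → ℝ)} (h : ∀ᵐ x ∂F, ∀ b, 0 ≤ x b) :
    ∫⁻ x, ENNReal.ofReal (∑ b, x b) ∂F = ∑ b, ∫⁻ x, ENNReal.ofReal (x b) ∂F := by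
  rw [← lintegral_finsetSum _ fun b _ => by fun_prop]
  refine lintegral_congr_ae ?_
  filter_upwards [h] with x hx
  exact ENNReal.ofReal_sum_of_nonneg fun b _ => hx b

lemma HasMarginals.isStrategy {F : Measure (Fin n → ℝ)} {c p γ : Fin n → ℝ} {R : ℝ}
    (h : HasMarginals F fun b => rampCdf (c b) (p b) (γ b)) (hc : ∀ b, 0 ≤ c b)
    (hp : ∀ b, 0 ≤ p b) (hγ : ∀ b, 0 < γ b)
    (hR : ∑ b, (c b * p b + c b ^ 2 * γ b / 2) ≤ R) : IsStrategy R F := by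
  have hnn := h.nonneg fun b t ht => by simp [rampCdf, ht]
  refine ⟨h.isProbabilityMeasure, hnn, ?_⟩
  rw [lintegral_sum_coord hnn, Finset.sum_congr rfl fun b _ => h.lintegral_rampCdf hc hp hγ b,
    ← ENNReal.ofReal_sum_of_nonneg]
  · exact ENNReal.ofReal_le_ofReal hR
  · intro b _
    have := hc b; have := hp b; have := hγ b
    positivity

/-! ### The contested range of a battlefield -/

/-- Length of the range of allocations over which a battlefield is contested. -/
def contested (α β p : ℝ) : ℝ := min (max 0 (β - p)) α

section contested

variable {α β p : ℝ}

lemma contested_of_le (hα : 0 < α) (h : β ≤ p) : contested α β p = 0 := by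
  rw [contested, max_eq_left (by linarith), min_eq_left hα.le]

lemma contested_of_type1 (h : ¬β ≤ p) (h' : β - p ≤ α) : contested α β p = β - p := by
  rw [contested, max_eq_right (by linarith), min_eq_left h']

lemma contested_of_type2 (h : ¬β ≤ p) (h' : ¬β - p ≤ α) : contested α β p = α := by
  rw [contested, max_eq_right (by linarith), min_eq_right (by linarith)]

lemma contested_nonneg (hα : 0 < α) : 0 ≤ contested α β p := le_min (le_max_left _ _) hα.le

lemma contested_le_left : contested α β p ≤ α := min_le_right _ _

lemma contested_le_right (hβ : 0 < β) (hp : 0 ≤ p) : contested α β p ≤ β :=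
  (min_le_left _ _).trans (max_le hβ.le (by linarith))

/-- This and `marginalB_eq` replace the three battlefield types by one ramp law with parameter
`contested α β p`, so that budgets and bounds are computed uniformly. -/
lemma marginalA_eq (hα : 0 < α) (hβ : 0 < β) (t : ℝ) :
    marginalA α β p t = rampCdf (contested α β p / β) 0 β t := by
  unfold marginalA rampCdf
  split_ifs with h1 h2 h3
  · rfl
  · rw [contested_of_le hα h2]
    simp
  · have : 0 ≤ t / β := div_nonneg (not_lt.1 h1) hβ.le
    rw [contested_of_type1 h2 h3, sub_zero, min_eq_right (sub_le_self _ this),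
      ← min_sub_sub_left, sub_zero]
    congr 1
    field_simp
    ring
  · have : 0 ≤ t / β := div_nonneg (not_lt.1 h1) hβ.le
    rw [contested_of_type2 h2 h3, sub_zero, min_eq_right (sub_le_self _ this),
      ← min_sub_sub_left, sub_zero, sub_div]

lemma marginalB_eq (hα : 0 < α) (t : ℝ) :
    marginalB α β p t = rampCdf (contested α β p / α) p α t := by
  unfold marginalB rampCdf
  split_ifs with h1 h2 h3 h4 h5
  · rfl
  · rw [contested_of_le hα h2]
    simp
  · have h : (t - p) / α ≤ 0 := div_nonpos_of_nonpos_of_nonneg (by linarith) hα.le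
    have h' : 0 ≤ (β - p) / α := div_nonneg (by linarith) hα.le
    rw [contested_of_type1 h2 h3, min_eq_left (by linarith), max_eq_right h']
  · have h : 0 ≤ (t - p) / α := div_nonneg (by linarith) hα.le
    rw [contested_of_type1 h2 h3, min_eq_right (sub_le_self _ h), ← min_sub_sub_left, sub_zero,
      ← sub_div, sub_sub_sub_cancel_right]
  · have h : (t - p) / α ≤ 0 := div_nonpos_of_nonpos_of_nonneg (by linarith) hα.le
    rw [contested_of_type2 h2 h3, div_self hα.ne', min_eq_left (by linarith),
      max_eq_right zero_le_one, sub_self]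
  · have h : 0 ≤ (t - p) / α := div_nonneg (by linarith) hα.le
    rw [contested_of_type2 h2 h3, div_self hα.ne', min_eq_right (sub_le_self _ h),
      ← min_sub_sub_left, sub_zero, sub_sub_cancel]

lemma spendA_eq (hα : 0 < α) : spendA α β p = contested α β p ^ 2 / (2 * β) := by
  unfold spendA
  split_ifs with h1 h2
  · simp [contested_of_le hα h1]
  · rw [contested_of_type1 h1 h2]
  · rw [contested_of_type2 h1 h2]

lemma spendB_eq (hα : 0 < α) :
    spendB α β p = contested α β p * (contested α β p + 2 * p) / (2 * α) := by
  unfold spendB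
  split_ifs with h1 h2
  · simp [contested_of_le hα h1]
  · rw [contested_of_type1 h1 h2]
    ring
  · rw [contested_of_type2 h1 h2]
    ring

lemma winProbA_eq (hα : 0 < α) (hβ : 0 < β) :
    winProbA α β p = 1 - contested α β p / α + spendA α β p / α := by
  rw [spendA_eq hα]
  unfold winProbA
  split_ifs with h1 h2
  · simp [contested_of_le hα h1]
  · rw [contested_of_type1 h1 h2]
    field_simp
    ring
  · rw [contested_of_type2 h1 h2]
    field_simp
    ring

/-- `A`'s equilibrium allocation wins against `y` with at least an affine probability. -/
lemma winProbA_add_sub_le (hα : 0 < α) (hβ : 0 < β) {y : ℝ} (hy : 0 ≤ y) :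
    winProbA α β p + spendB α β p / β - y / β ≤
      1 - rampCdf (contested α β p / β) 0 β (y - p) := by
  -- The intercept of the affine bound: it is `1` on type 1 and uncontested battlefields and `(α +
  -- p) / β` on type 2. On contested battlefields the bound is then tight for `p ≤ y` up to the top
  -- of the ramp; for `y < p`, `A` wins surely.
  have hkey : winProbA α β p + spendB α β p / β =
      1 - contested α β p / α * ((β - p - contested α β p) / β) := by
    rw [winProbA_eq hα hβ, spendA_eq hα, spendB_eq hα]
    field_simp
    ring
  rw [hkey]
  have hyβ : 0 ≤ y / β := div_nonneg hy hβ.le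
  unfold rampCdf
  split_ifs with h
  · have : 0 ≤ contested α β p / α * ((β - p - contested α β p) / β) := by
      by_cases h1 : β ≤ p
      · simp [contested_of_le hα h1]
      · refine mul_nonneg (div_nonneg (contested_nonneg hα) hα.le) (div_nonneg ?_ hβ.le)
        have : contested α β p ≤ max 0 (β - p) := min_le_left _ _
        rw [max_eq_right (by linarith)] at this
        linarith
    linarith
  · have h0 : 0 ≤ (y - p) / β := div_nonneg (by linarith) hβ.le
    rw [sub_zero, min_eq_right (by linarith), sub_sub_cancel]
    by_cases h1 : β ≤ p
    · refine le_trans ?_ (le_max_left _ _)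
      have : 1 ≤ y / β := by rw [le_div_iff₀ hβ]; linarith
      simp [contested_of_le hα h1, this]
    refine le_trans (le_of_eq ?_) (le_max_right _ _)
    by_cases h2 : β - p ≤ α
    · rw [contested_of_type1 h1 h2]
      field_simp
      ring
    · rw [contested_of_type2 h1 h2]
      field_simp
      ring

end contested

/-- A ramp starting at `p` loses to `x + p` with at most an affine probability. -/
lemma rampCdf_add_le {c p γ x : ℝ} (hγ : 0 < γ) (hp : 0 ≤ p) (hx : 0 ≤ x) :
    rampCdf c p γ (x + p) ≤ 1 - c + x / γ := by
  have h : 0 ≤ x / γ := div_nonneg hx hγ.le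
  rw [rampCdf, if_neg (by linarith), add_sub_cancel_right, min_eq_right (by linarith)]
  linarith [le_max_right 0 (c - x / γ)]

/-! ### Equilibrium of the second stage -/

section secondStage

variable {w τ p : Fin n → ℝ} {RA RB κA κB : ℝ}

lemma hasMarginalsA_iff (hw : ∀ b, 0 < w b) (hA : 0 < κA) (hB : 0 < κB)
    (F : Measure (Fin n → ℝ)) :
    HasMarginals F (fun b => marginalA (w b * κA) (w b * κB) (p b)) ↔
      HasMarginals F fun b => rampCdf (contested (w b * κA) (w b * κB) (p b) / (w b * κB))
        0 (w b * κB) := by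
  have : (fun b => marginalA (w b * κA) (w b * κB) (p b)) =
      fun b => rampCdf (contested (w b * κA) (w b * κB) (p b) / (w b * κB)) 0 (w b * κB) := by
    ext b t
    exact marginalA_eq (mul_pos (hw b) hA) (mul_pos (hw b) hB) t
  rw [this]

lemma hasMarginalsB_iff (hw : ∀ b, 0 < w b) (hA : 0 < κA) (F : Measure (Fin n → ℝ)) :
    HasMarginals F (fun b => marginalB (w b * κA) (w b * κB) (p b)) ↔
      HasMarginals F fun b => rampCdf (contested (w b * κA) (w b * κB) (p b) / (w b * κA))
        (p b) (w b * κA) := by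
  have : (fun b => marginalB (w b * κA) (w b * κB) (p b)) =
      fun b => rampCdf (contested (w b * κA) (w b * κB) (p b) / (w b * κA))
        (p b) (w b * κA) := by
    ext b t
    exact marginalB_eq (mul_pos (hw b) hA) t
  rw [this]

lemma exists_hasMarginalsA (hw : ∀ b, 0 < w b) (hp : ∀ b, 0 ≤ p b) (hA : 0 < κA) (hB : 0 < κB) :
    ∃ F, HasMarginals F fun b => marginalA (w b * κA) (w b * κB) (p b) := by
  simp_rw [hasMarginalsA_iff hw hA hB]
  have hβ : ∀ b, 0 < w b * κB := fun b => mul_pos (hw b) hB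
  exact exists_hasMarginals_rampCdf
    (fun b => (div_le_one (hβ b)).2 (contested_le_right (hβ b) (hp b))) hβ

lemma exists_hasMarginalsB (hw : ∀ b, 0 < w b) (hA : 0 < κA) :
    ∃ F, HasMarginals F fun b => marginalB (w b * κA) (w b * κB) (p b) := by
  simp_rw [hasMarginalsB_iff hw hA]
  have hα : ∀ b, 0 < w b * κA := fun b => mul_pos (hw b) hA
  exact exists_hasMarginals_rampCdf (fun b => (div_le_one (hα b)).2 contested_le_left) hα

lemma isStrategy_marginalA (hw : ∀ b, 0 < w b)
    (hκ : IsKappa w p RA RB κA κB) {F : Measure (Fin n → ℝ)}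
    (hF : HasMarginals F fun b => marginalA (w b * κA) (w b * κB) (p b)) : IsStrategy RA F := by
  rw [hasMarginalsA_iff hw hκ.posA hκ.posB] at hF
  have hα : ∀ b, 0 < w b * κA := fun b => mul_pos (hw b) hκ.posA
  have hβ : ∀ b, 0 < w b * κB := fun b => mul_pos (hw b) hκ.posB
  refine hF.isStrategy (fun b => div_nonneg (contested_nonneg (hα b)) (hβ b).le)
    (fun _ => le_rfl) hβ (le_of_eq ?_)
  rw [← hκ.eqA]
  refine Finset.sum_congr rfl fun b _ => ?_
  have := hβ b
  rw [spendA_eq (hα b), mul_zero, zero_add]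
  field_simp

lemma isStrategy_marginalB (hw : ∀ b, 0 < w b) (hp : ∀ b, 0 ≤ p b)
    (hκ : IsKappa w p RA RB κA κB) {F : Measure (Fin n → ℝ)}
    (hF : HasMarginals F fun b => marginalB (w b * κA) (w b * κB) (p b)) : IsStrategy RB F := by
  rw [hasMarginalsB_iff hw hκ.posA] at hF
  have hα : ∀ b, 0 < w b * κA := fun b => mul_pos (hw b) hκ.posA
  refine hF.isStrategy (fun b => div_nonneg (contested_nonneg (hα b)) (hα b).le) hp hα
    (le_of_eq ?_)
  rw [← hκ.eqB]
  refine Finset.sum_congr rfl fun b _ => ?_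
  have := (hw b).ne'
  have := hκ.posA.ne'
  rw [spendB_eq (hα b)]
  field_simp
  ring

/-- The payoff that the equilibrium allocations of `A` guarantee. -/
lemma value_le_payoffA (hw : ∀ b, 0 < w b) (hτ : ∀ b, 0 ≤ τ b ∧ τ b ≤ 1)
    (hRB : 0 ≤ RB) (hκ : IsKappa w p RA RB κA κB) {FA FB : Measure (Fin n → ℝ)}
    (hFA : HasMarginals FA fun b => marginalA (w b * κA) (w b * κB) (p b))
    (hFB : IsStrategy RB FB) :
    ∑ b, w b * winProbA (w b * κA) (w b * κB) (p b) ≤ payoffA w τ p FA FB := by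
  have := hFA.isProbabilityMeasure
  have hB := hκ.posB
  have hα : ∀ b, 0 < w b * κA := fun b => mul_pos (hw b) hκ.posA
  have hβ : ∀ b, 0 < w b * κB := fun b => mul_pos (hw b) hB
  rw [hasMarginalsA_iff hw hκ.posA hB] at hFA
  refine le_trans (le_of_eq ?_) (le_payoffA (c := fun b => winProbA (w b * κA) (w b * κB) (p b) +
    spendB (w b * κA) (w b * κB) (p b) / (w b * κB)) (μ := 1 / κB) hw hτ (by positivity) hRB hFB
    fun b y hy => ?_)
  · rw [← hκ.eqB, Finset.mul_sum, ← Finset.sum_sub_distrib]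
    refine Finset.sum_congr rfl fun b _ => ?_
    have := (hw b).ne'
    field_simp
    ring
  · have hset : {x : Fin n → ℝ | y < x b + p b} = {x | y - p b < x b} := by
      ext x; simp [sub_lt_iff_lt_add]
    rw [hset, hFA.real_Ioi]
    have h := mul_le_mul_of_nonneg_left (winProbA_add_sub_le (p := p b) (hα b) (hβ b) hy) (hw b).le
    refine le_trans (le_of_eq ?_) h
    have := (hw b).ne'
    field_simp

/-- The payoff to which the equilibrium allocations of `B` hold `A` down. -/
lemma payoffA_le_value (hw : ∀ b, 0 < w b) (hτ : ∀ b, 0 ≤ τ b ∧ τ b ≤ 1) (hp : ∀ b, 0 ≤ p b)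
    (hRA : 0 ≤ RA) (hκ : IsKappa w p RA RB κA κB) {FA FB : Measure (Fin n → ℝ)}
    (hFB : HasMarginals FB fun b => marginalB (w b * κA) (w b * κB) (p b))
    (hFA : IsStrategy RA FA) :
    payoffA w τ p FA FB ≤ ∑ b, w b * winProbA (w b * κA) (w b * κB) (p b) := by
  have := hFB.isProbabilityMeasure
  have hA := hκ.posA
  have hα : ∀ b, 0 < w b * κA := fun b => mul_pos (hw b) hA
  have hβ : ∀ b, 0 < w b * κB := fun b => mul_pos (hw b) hκ.posB
  rw [hasMarginalsB_iff hw hA] at hFB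
  refine le_trans (payoffA_le (d := fun b => 1 - contested (w b * κA) (w b * κB) (p b) /
    (w b * κA)) (l := 1 / κA) hw hτ (by positivity) hRA hFA fun b x hx => ?_) (le_of_eq ?_)
  · rw [hFB.real_Iic]
    have h := mul_le_mul_of_nonneg_left (rampCdf_add_le
      (c := contested (w b * κA) (w b * κB) (p b) / (w b * κA)) (hα b) (hp b) hx) (hw b).le
    refine h.trans (le_of_eq ?_)
    have := (hw b).ne'
    field_simp
  · rw [← hκ.eqA, Finset.mul_sum, ← Finset.sum_add_distrib]
    refine Finset.sum_congr rfl fun b _ => ?_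
    have := (hw b).ne'
    rw [winProbA_eq (hα b) (hβ b)]
    field_simp

lemma isNash_of_marginals (hw : ∀ b, 0 < w b) (hτ : ∀ b, 0 ≤ τ b ∧ τ b ≤ 1)
    (hp : ∀ b, 0 ≤ p b) (hRA : 0 ≤ RA) (hRB : 0 ≤ RB) (hκ : IsKappa w p RA RB κA κB)
    {FA FB : Measure (Fin n → ℝ)}
    (hFA : HasMarginals FA fun b => marginalA (w b * κA) (w b * κB) (p b))
    (hFB : HasMarginals FB fun b => marginalB (w b * κA) (w b * κB) (p b)) :
    IsNash w τ p RA RB FA FB := by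
  have hA := isStrategy_marginalA hw hκ hFA
  have hB := isStrategy_marginalB hw hp hκ hFB
  refine ⟨hA, hB, fun GA hGA => ?_, fun GB hGB => ?_⟩
  · exact (payoffA_le_value hw hτ hp hRA hκ hFB hGA).trans
      (value_le_payoffA hw hτ hRB hκ hFA hB)
  · exact sub_le_sub_left ((payoffA_le_value hw hτ hp hRA hκ hFB hA).trans
      (value_le_payoffA hw hτ hRB hκ hFA hGB)) 1

/-- In a zero-sum game a maximin guarantee bounds every equilibrium payoff, since deviating to the
guaranteeing strategy cannot be profitable. -/
lemma IsNash.le_payoffA_of_guarantee {FA FB : Measure (Fin n → ℝ)} {v : ℝ}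
    (h : IsNash w τ p RA RB FA FB)
    (hv : ∃ GA, IsStrategy RA GA ∧ ∀ GB, IsStrategy RB GB → v ≤ payoffA w τ p GA GB) :
    v ≤ payoffA w τ p FA FB := by
  obtain ⟨GA, hGA, hGA'⟩ := hv
  exact (hGA' FB h.strategyB).trans (h.optimalA GA hGA)

lemma IsNash.payoffA_le_of_guarantee {FA FB : Measure (Fin n → ℝ)} {v : ℝ}
    (h : IsNash w τ p RA RB FA FB)
    (hv : ∃ GB, IsStrategy RB GB ∧ ∀ GA, IsStrategy RA GA → payoffA w τ p GA GB ≤ v) :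
    payoffA w τ p FA FB ≤ v := by
  obtain ⟨GB, hGB, hGB'⟩ := hv
  have := h.optimalB GB hGB
  unfold payoffB at this
  linarith [hGB' FA h.strategyA]

lemma IsNash.payoffA_eq (hw : ∀ b, 0 < w b) (hτ : ∀ b, 0 ≤ τ b ∧ τ b ≤ 1)
    (hp : ∀ b, 0 ≤ p b) (hRA : 0 ≤ RA) (hRB : 0 ≤ RB) (hκ : IsKappa w p RA RB κA κB)
    {FA FB : Measure (Fin n → ℝ)} (h : IsNash w τ p RA RB FA FB) :
    payoffA w τ p FA FB = ∑ b, w b * winProbA (w b * κA) (w b * κB) (p b) := by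
  obtain ⟨GA, hGA⟩ := exists_hasMarginalsA hw hp hκ.posA hκ.posB
  obtain ⟨GB, hGB⟩ := exists_hasMarginalsB (κB := κB) (p := p) hw hκ.posA
  refine le_antisymm
    (h.payoffA_le_of_guarantee ⟨GB, isStrategy_marginalB hw hp hκ hGB, fun G hG => ?_⟩)
    (h.le_payoffA_of_guarantee ⟨GA, isStrategy_marginalA hw hκ hGA, fun G hG => ?_⟩)
  · exact payoffA_le_value hw hτ hp hRA hκ hGB hG
  · exact value_le_payoffA hw hτ hRB hκ hGA hG

end secondStage

/-! ### Closed forms of `κ_A` and `κ_B` -/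

/-- `h₁` and `h₂` are half the difference and half the sum of the cleared budget equations.
Eliminating `N` yields `D x² = H₁ (C₁ y + C₂ x)` and `H₁ y² = H₂ x²`. The first forces `0 ≤ H₁`,
which fixes the branch `√(H₁ H₂) = H₁ y / x` without any sign assumption on `C₂`. -/
lemma kappa_closed_form {W₁ W₂ N C₁ C₂ x y : ℝ} (hW₁ : 0 ≤ W₁) (hW₂ : 0 ≤ W₂)
    (hx : 0 < x) (hy : 0 < y) (h₁ : C₁ * y - C₂ * x = N)
    (h₂ : W₁ * y ^ 2 + W₂ * x ^ 2 = C₁ * y + C₂ * x) (hD : 0 < W₁ * C₂ ^ 2 + W₂ * C₁ ^ 2) :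
    x = (C₂ * (C₁ ^ 2 - W₁ * N) + C₁ * √((C₁ ^ 2 - W₁ * N) * (C₂ ^ 2 + W₂ * N))) /
        (W₁ * C₂ ^ 2 + W₂ * C₁ ^ 2) ∧
      y = (C₁ * (C₂ ^ 2 + W₂ * N) + C₂ * √((C₁ ^ 2 - W₁ * N) * (C₂ ^ 2 + W₂ * N))) /
        (W₁ * C₂ ^ 2 + W₂ * C₁ ^ 2) := by
  set D := W₁ * C₂ ^ 2 + W₂ * C₁ ^ 2 with hDdef
  set H₁ := C₁ ^ 2 - W₁ * N with hH₁
  set H₂ := C₂ ^ 2 + W₂ * N with hH₂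
  have key : D * x ^ 2 = H₁ * (C₁ * y + C₂ * x) := by
    rw [hDdef, hH₁, ← h₁]
    linear_combination C₁ ^ 2 * h₂
  have ratio : H₁ * y ^ 2 = H₂ * x ^ 2 := by
    rw [hH₁, hH₂, ← h₁]
    linear_combination (-(C₁ * y - C₂ * x)) * h₂
  have hE : 0 ≤ C₁ * y + C₂ * x := by rw [← h₂]; positivity
  have hH₁pos : 0 ≤ H₁ := by
    by_contra! hneg
    have : 0 < D * x ^ 2 := by positivity
    nlinarith [mul_nonneg (neg_nonneg.2 hneg.le) hE]
  have hsqrt : √(H₁ * H₂) = H₁ * y / x := by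
    have hsq : H₁ * H₂ = (H₁ * y / x) ^ 2 := by
      rw [div_pow, eq_div_iff (by positivity)]
      linear_combination (-H₁) * ratio
    rw [hsq, Real.sqrt_sq (by positivity)]
  rw [hsqrt]
  constructor
  · rw [eq_div_iff hD.ne']
    field_simp
    linear_combination key
  · rw [eq_div_iff hD.ne']
    field_simp
    have hxy : y * D * x = C₁ * H₂ * x + C₂ * H₁ * y :=
      mul_left_cancel₀ hx.ne' (by linear_combination y * key + C₁ * ratio)
    linear_combination hxy

section kappa

variable {w p : Fin n → ℝ} {RA RB κA κB : ℝ}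

/-- The budget equation multiplied by `2 κB`, which makes it polynomial in `κA` and `κB`; `budgetB`
uses `2 κA` instead. -/
lemma IsKappa.budgetA (hw : ∀ b, 0 < w b) (h : IsKappa w p RA RB κA κB) :
    (∑ b ∈ type1 w p κA κB, w b) * κB ^ 2 - 2 * κB * ∑ b ∈ type1 w p κA κB, p b +
      ∑ b ∈ type1 w p κA κB, p b ^ 2 / w b + (∑ b ∈ type2 w p κA κB, w b) * κA ^ 2 =
      2 * RA * κB := by
  have hB := h.posB
  rw [← h.eqA, Finset.sum_mul, Finset.sum_mul, Finset.mul_sum, Finset.mul_sum, Finset.sum_mul,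
    ← Finset.sum_sub_distrib, ← Finset.sum_add_distrib, type1, type2, Finset.sum_filter,
    Finset.sum_filter, ← Finset.sum_add_distrib]
  refine Finset.sum_congr rfl fun b _ => ?_
  have hwb := hw b
  have hα : 0 < w b * κA := mul_pos hwb h.posA
  unfold spendA
  split_ifs <;> first | (exfalso; linarith) | (exfalso; simp_all; done) | (field_simp; ring)

lemma IsKappa.budgetB (hw : ∀ b, 0 < w b) (h : IsKappa w p RA RB κA κB) :
    (∑ b ∈ type1 w p κA κB, w b) * κB ^ 2 - ∑ b ∈ type1 w p κA κB, p b ^ 2 / w b +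
      (∑ b ∈ type2 w p κA κB, w b) * κA ^ 2 + 2 * κA * ∑ b ∈ type2 w p κA κB, p b =
      2 * RB * κA := by
  have hA := h.posA
  rw [← h.eqB, Finset.sum_mul, Finset.sum_mul, Finset.mul_sum, Finset.mul_sum, Finset.sum_mul,
    ← Finset.sum_sub_distrib, add_assoc, ← Finset.sum_add_distrib, type1, type2,
    Finset.sum_filter, Finset.sum_filter, ← Finset.sum_add_distrib]
  refine Finset.sum_congr rfl fun b _ => ?_
  have hwb := hw b
  have hα : 0 < w b * κA := mul_pos hwb h.posA
  unfold spendB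
  split_ifs <;> first | (exfalso; linarith) | (exfalso; simp_all; done) | (field_simp; ring)

lemma IsKappa.eq_closed_form (hw : ∀ b, 0 < w b) (hp : ∀ b, 0 ≤ p b) (hRA : 0 < RA)
    (hRB : 0 < RB) (h : IsKappa w p RA RB κA κB) :
    κA = kappaA w p RA RB (type1 w p κA κB) (type2 w p κA κB) ∧
      κB = kappaB w p RA RB (type1 w p κA κB) (type2 w p κA κB) := by
  have hA := h.posA
  have h1 := h.budgetA hw
  have h2 := h.budgetB hw
  have hN : 0 ≤ ∑ b ∈ type1 w p κA κB, p b ^ 2 / w b :=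
    Finset.sum_nonneg fun b _ => div_nonneg (sq_nonneg _) (hw b).le
  have hP₁ : 0 ≤ ∑ b ∈ type1 w p κA κB, p b := Finset.sum_nonneg fun b _ => hp b
  have hW₁ : 0 ≤ ∑ b ∈ type1 w p κA κB, w b := Finset.sum_nonneg fun b _ => (hw b).le
  have hW₂ : 0 ≤ ∑ b ∈ type2 w p κA κB, w b := Finset.sum_nonneg fun b _ => (hw b).le
  unfold kappaA kappaB kappaDenom hOne hTwo
  have hC₁ : 0 < cOne p RA (type1 w p κA κB) := by unfold cOne; linarith
  refine kappa_closed_form hW₁ hW₂ hA h.posB ?_ ?_ ?_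
  · unfold cOne cTwo
    linarith
  · unfold cOne cTwo
    linarith
  -- The denominator is positive because `C₁ > 0`, and `C₂ = RB` when type 2 is empty. Both types
  -- cannot be empty, since `B` would then spend nothing.
  · rcases Finset.eq_empty_or_nonempty (type2 w p κA κB) with h0 | h0
    · rcases Finset.eq_empty_or_nonempty (type1 w p κA κB) with h0' | h0'
      · rw [h0, h0'] at h2
        simp only [Finset.sum_empty] at h2
        nlinarith [mul_pos hRB hA]
      · have hC₂ : cTwo p RB (type2 w p κA κB) = RB := by simp [cTwo, h0]
        have := Finset.sum_pos (fun b _ => hw b) h0'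
        rw [hC₂]
        positivity
    · have := Finset.sum_pos (fun b _ => hw b) h0
      positivity

end kappa

/-! ### Existence of `κ_A` and `κ_B` -/

/-- The contested range relative to `κ_B`, for `ρ = κ_A / κ_B` and `u = 1 / κ_B`. -/
def relContested (q ρ u : ℝ) : ℝ := min (max 0 (1 - q * u)) ρ

lemma relContested_nonneg {q ρ u : ℝ} (hρ : 0 ≤ ρ) : 0 ≤ relContested q ρ u :=
  le_min (le_max_left _ _) hρ

lemma relContested_anti {q ρ u v : ℝ} (hq : 0 ≤ q) (h : u ≤ v) :
    relContested q ρ v ≤ relContested q ρ u := by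
  unfold relContested
  have := mul_le_mul_of_nonneg_left h hq
  gcongr

section existence

variable {w q : Fin n → ℝ} {RA RB : ℝ}

lemma strictAnti_budgetA (hw : ∀ b, 0 < w b) (hq : ∀ b, 0 ≤ q b) (hRA : 0 < RA) {ρ : ℝ}
    (hρ : 0 ≤ ρ) :
    StrictAnti fun u => ∑ b, w b * relContested (q b) ρ u ^ 2 - 2 * RA * u := by
  intro u v huv
  have h1 : ∑ b, w b * relContested (q b) ρ v ^ 2 ≤ ∑ b, w b * relContested (q b) ρ u ^ 2 := by
    refine Finset.sum_le_sum fun b _ => mul_le_mul_of_nonneg_left ?_ (hw b).le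
    exact pow_le_pow_left₀ (relContested_nonneg hρ) (relContested_anti (hq b) huv.le) 2
  have h2 : 2 * RA * u < 2 * RA * v := by gcongr
  simp only
  linarith

lemma exists_root_budgetA (hw : ∀ b, 0 < w b) (hw1 : ∑ b, w b = 1) (hRA : 0 < RA) {ρ : ℝ}
    (hρ : 0 < ρ) : ∃ u, 0 < u ∧ ∑ b, w b * relContested (q b) ρ u ^ 2 - 2 * RA * u = 0 := by
  have hcont : Continuous fun u => ∑ b, w b * relContested (q b) ρ u ^ 2 - 2 * RA * u := by
    unfold relContested; fun_prop
  have h0 : 0 < ∑ b, w b * relContested (q b) ρ 0 ^ 2 - 2 * RA * 0 := by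
    have : ∀ b, relContested (q b) ρ 0 = min 1 ρ := fun b => by simp [relContested]
    simp_rw [this]
    rw [← Finset.sum_mul, hw1]
    have : 0 < min 1 ρ := lt_min one_pos hρ
    simp only [one_mul, mul_zero, sub_zero]
    positivity
  -- The right end `ρ² / (2 RA)` of the search interval comes from `relContested ≤ ρ`.
  have hρ' : ∑ b, w b * relContested (q b) ρ (ρ ^ 2 / (2 * RA)) ^ 2 -
      2 * RA * (ρ ^ 2 / (2 * RA)) ≤ 0 := by
    have h1 : ∑ b, w b * relContested (q b) ρ (ρ ^ 2 / (2 * RA)) ^ 2 ≤ ∑ b, w b * ρ ^ 2 := by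
      refine Finset.sum_le_sum fun b _ => mul_le_mul_of_nonneg_left ?_ (hw b).le
      exact pow_le_pow_left₀ (relContested_nonneg hρ.le) (min_le_right _ _) 2
    rw [← Finset.sum_mul, hw1] at h1
    have h2 : 2 * RA * (ρ ^ 2 / (2 * RA)) = ρ ^ 2 := by field_simp
    linarith
  obtain ⟨u, hu, hu'⟩ := intermediate_value_Icc' (by positivity : 0 ≤ ρ ^ 2 / (2 * RA))
    hcont.continuousOn ⟨hρ', h0.le⟩
  refine ⟨u, lt_of_le_of_ne hu.1 ?_, hu'⟩
  rintro rfl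
  simp only at hu'
  linarith

/-- The zero of a function that decreases strictly in its second argument depends
continuously on the first. -/
lemma continuousOn_root {g : ℝ → ℝ → ℝ} {U : ℝ → ℝ} {s : Set ℝ}
    (hg : ∀ u, Continuous fun ρ => g ρ u) (hanti : ∀ ρ ∈ s, StrictAnti (g ρ))
    (hU : ∀ ρ ∈ s, g ρ (U ρ) = 0) : ContinuousOn U s := by
  intro ρ hρ
  rw [ContinuousWithinAt, tendsto_order]
  constructor
  · intro a ha
    -- The sign of `g · a` persists near `ρ` by continuity in the first argument alone; monotonicity
    -- in the second then places the root on the correct side of `a`.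
    have h : 0 < g ρ a := by rw [← hU ρ hρ]; exact hanti ρ hρ ha
    have h' := (hg a).continuousAt.eventually (lt_mem_nhds h)
    filter_upwards [mem_nhdsWithin_of_mem_nhds h', self_mem_nhdsWithin] with σ hσ hσs
    by_contra! hle
    have := (hanti σ hσs).antitone hle
    rw [hU σ hσs] at this
    exact absurd hσ (not_lt.2 this)
  · intro a ha
    have h : g ρ a < 0 := by rw [← hU ρ hρ]; exact hanti ρ hρ ha
    have h' := (hg a).continuousAt.eventually (gt_mem_nhds h)
    filter_upwards [mem_nhdsWithin_of_mem_nhds h', self_mem_nhdsWithin] with σ hσ hσs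
    by_contra! hle
    have := (hanti σ hσs).antitone hle
    rw [hU σ hσs] at this
    exact absurd hσ (not_lt.2 this)

/-- For fixed `ρ` the first equation has a unique root `U ρ`, continuous in `ρ`. The residual `h` of
the second equation along this curve changes sign on `[RA / RB, b]`. -/
lemma exists_relative_solution (hw : ∀ b, 0 < w b) (hw1 : ∑ b, w b = 1) (hq : ∀ b, 0 ≤ q b)
    (hRA : 0 < RA) (hRB : 0 < RB) :
    ∃ ρ u, 0 < ρ ∧ 0 < u ∧ ∑ b, w b * relContested (q b) ρ u ^ 2 = 2 * RA * u ∧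
      ∑ b, w b * (relContested (q b) ρ u * (relContested (q b) ρ u + 2 * (q b * u))) =
        2 * RB * ρ * u := by
  have hex : ∀ ρ : ℝ, ∃ u, 0 < ρ →
      0 < u ∧ ∑ b, w b * relContested (q b) ρ u ^ 2 - 2 * RA * u = 0 := fun ρ => by
    by_cases hρ : 0 < ρ
    · obtain ⟨u, hu⟩ := exists_root_budgetA (q := q) hw hw1 hRA hρ
      exact ⟨u, fun _ => hu⟩
    · exact ⟨0, fun h => absurd h hρ⟩
  choose U hU using hex
  have hUcont : ContinuousOn U (Set.Ioi 0) := by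
    refine continuousOn_root
      (g := fun ρ u => ∑ b, w b * relContested (q b) ρ u ^ 2 - 2 * RA * u) (fun u => ?_)
      (fun ρ hρ => strictAnti_budgetA hw hq hRA (le_of_lt hρ)) (fun ρ hρ => (hU ρ hρ).2)
    unfold relContested
    fun_prop
  let h : ℝ → ℝ := fun ρ => ∑ b, w b * (relContested (q b) ρ (U ρ) *
    (relContested (q b) ρ (U ρ) + 2 * (q b * U ρ))) - 2 * RB * ρ * U ρ
  have hcont : ContinuousOn h (Set.Ioi 0) := by
    simp only [h, relContested]
    fun_prop
  set a := RA / RB with ha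
  have hapos : 0 < a := by positivity
  have hU1 := (hU 1 one_pos).1
  set b := max a (max 1 (1 / (2 * RB * U 1))) with hb
  have hb1 : 1 ≤ b := (le_max_left _ _).trans (le_max_right _ _)
  have hb2 : 1 / (2 * RB * U 1) ≤ b := (le_max_right _ _).trans (le_max_right _ _)
  -- For `ρ = RA / RB` the right sides of both equations agree, while the left side of the second
  -- dominates that of the first.
  have hha : 0 ≤ h a := by
    obtain ⟨hu, hu'⟩ := hU a hapos
    have h1 : ∑ b, w b * relContested (q b) a (U a) ^ 2 ≤
        ∑ b, w b * (relContested (q b) a (U a) *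
          (relContested (q b) a (U a) + 2 * (q b * U a))) := by
      refine Finset.sum_le_sum fun b _ => mul_le_mul_of_nonneg_left ?_ (hw b).le
      have := mul_nonneg (relContested_nonneg (q := q b) (u := U a) hapos.le)
        (mul_nonneg (hq b) hu.le)
      nlinarith
    have h2 : 2 * RB * a * U a = 2 * RA * U a := by rw [ha]; field_simp
    simp only [h]
    linarith
  -- For `ρ ≥ 1` the cap `ρ` is inactive, so `U` is constant. The left side is at most `1`, as `(1 -
  -- q u)(1 + q u) ≤ 1`, and `b` was chosen so that `2 RB b U 1 ≥ 1`.
  have hhb : h b ≤ 0 := by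
    have hbpos : 0 < b := one_pos.trans_le hb1
    have hrel : ∀ (i : Fin n) u, 0 ≤ u → relContested (q i) b u = relContested (q i) 1 u := by
      intro i u hu
      have : max 0 (1 - q i * u) ≤ 1 :=
        max_le zero_le_one (by linarith [mul_nonneg (hq i) hu])
      rw [relContested, relContested, min_eq_left this, min_eq_left (this.trans hb1)]
    have hUb : U b = U 1 := by
      refine (strictAnti_budgetA (w := w) hw hq hRA hbpos.le).injective ?_
      rw [(hU b hbpos).2]
      simp_rw [hrel _ _ hU1.le]
      rw [(hU 1 one_pos).2]
    have h1 : ∑ i, w i * (relContested (q i) b (U 1) *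
        (relContested (q i) b (U 1) + 2 * (q i * U 1))) ≤ ∑ i, w i * 1 := by
      refine Finset.sum_le_sum fun i _ => mul_le_mul_of_nonneg_left ?_ (hw i).le
      rw [hrel i _ hU1.le, relContested]
      have hqu := mul_nonneg (hq i) hU1.le
      have : max 0 (1 - q i * U 1) ≤ 1 := max_le zero_le_one (by linarith)
      rw [min_eq_left this]
      rcases le_total (1 - q i * U 1) 0 with h0 | h0
      · simp [max_eq_left h0]
      · rw [max_eq_right h0]
        nlinarith
    simp only [mul_one, hw1] at h1
    rw [div_le_iff₀ (by positivity)] at hb2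
    simp only [h, hUb]
    linarith
  obtain ⟨ρ, hρ, hρ0⟩ := intermediate_value_Icc' (le_max_left _ _ : a ≤ b)
    (hcont.mono fun x hx => hapos.trans_le hx.1) ⟨hhb, hha⟩
  have hρpos : 0 < ρ := hapos.trans_le hρ.1
  obtain ⟨hu, hu'⟩ := hU ρ hρpos
  exact ⟨ρ, U ρ, hρpos, hu, by linarith, by simp only [h] at hρ0; linarith⟩

lemma exists_isKappa {p : Fin n → ℝ} (hw : ∀ b, 0 < w b) (hw1 : ∑ b, w b = 1)
    (hp : ∀ b, 0 ≤ p b) (hRA : 0 < RA) (hRB : 0 < RB) : ∃ κA κB, IsKappa w p RA RB κA κB := by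
  obtain ⟨ρ, u, hρ, hu, h1, h2⟩ := exists_relative_solution (q := fun b => p b / w b) hw hw1
    (fun b => div_nonneg (hp b) (hw b).le) hRA hRB
  have hm : ∀ b, contested (w b * (ρ / u)) (w b * (1 / u)) (p b) =
      w b / u * relContested (p b / w b) ρ u := by
    intro b
    have hwb := hw b
    have hpos : 0 ≤ w b / u := by positivity
    have e1 : w b * (1 / u) - p b = w b / u * (1 - p b / w b * u) := by field_simp
    have e2 : w b * (ρ / u) = w b / u * ρ := by ring
    rw [contested, relContested, mul_min_of_nonneg _ _ hpos, mul_max_of_nonneg _ _ hpos, mul_zero,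
      e1, e2]
  have hα : ∀ b, 0 < w b * (ρ / u) := fun b => mul_pos (hw b) (by positivity)
  refine ⟨ρ / u, 1 / u, by positivity, by positivity, ?_, ?_⟩
  · have : RA = (∑ b, w b * relContested (p b / w b) ρ u ^ 2) * (1 / (2 * u)) := by
      rw [h1]; field_simp
    rw [this, Finset.sum_mul]
    refine Finset.sum_congr rfl fun b _ => ?_
    have := (hw b).ne'
    rw [spendA_eq (hα b), hm]
    field_simp
  · have : RB = (∑ b, w b * (relContested (p b / w b) ρ u *
        (relContested (p b / w b) ρ u + 2 * (p b / w b * u)))) * (1 / (2 * ρ * u)) := by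
      rw [h2]; field_simp
    rw [this, Finset.sum_mul]
    refine Finset.sum_congr rfl fun b _ => ?_
    have := (hw b).ne'
    rw [spendB_eq (hα b), hm]
    field_simp

end existence

/-! ### Guarantees in the two-stage game -/

section guarantees

variable {w τ p : Fin n → ℝ} {P RA RB : ℝ}

/-- `B` holds `A` down by contesting every battlefield with the same probability `r`, whatever the
pre-allocation. -/
lemma exists_strategyB (hw : ∀ b, 0 < w b) (hw1 : ∑ b, w b = 1)
    (hτ : ∀ b, 0 ≤ τ b ∧ τ b ≤ 1) (hp : p ∈ preallocations n P) {r κ : ℝ} (hr : 0 ≤ r)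
    (hr1 : r ≤ 1) (hκ : 0 < κ) (hcost : r * (P + κ * r / 2) ≤ RB) (hRA : 0 ≤ RA) :
    ∃ FB, IsStrategy RB FB ∧ ∀ FA, IsStrategy RA FA → payoffA w τ p FA FB ≤ 1 - r + RA / κ := by
  have hγ : ∀ b, 0 < w b * κ := fun b => mul_pos (hw b) hκ
  obtain ⟨F, hF⟩ := exists_hasMarginals_rampCdf (c := fun _ => r) (p := p) (fun _ => hr1) hγ
  have := hF.isProbabilityMeasure
  refine ⟨F, hF.isStrategy (fun _ => hr) hp.1 hγ (le_trans (le_of_eq ?_) hcost), fun FA hFA => ?_⟩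
  · rw [Finset.sum_add_distrib, ← Finset.mul_sum, hp.2, ← Finset.sum_div, ← Finset.mul_sum,
      ← Finset.sum_mul, hw1]
    ring
  · refine (payoffA_le (d := fun _ => 1 - r) (l := 1 / κ) hw hτ (by positivity) hRA hFA
      fun b x hx => ?_).trans (le_of_eq ?_)
    · rw [hF.real_Iic]
      refine (mul_le_mul_of_nonneg_left (rampCdf_add_le (hγ b) (hp.1 b) hx) (hw b).le).trans
        (le_of_eq ?_)
      have := (hw b).ne'
      field_simp
    · rw [← Finset.sum_mul, hw1]
      ring

lemma isStrategy_dirac_zero (R : ℝ) : IsStrategy R (Measure.dirac (0 : Fin n → ℝ)) := by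
  refine ⟨inferInstance, ?_, ?_⟩
  · rw [ae_dirac_eq]
    exact fun _ => le_rfl
  · rw [lintegral_dirac]
    simp

lemma eq_dirac_zero_of_isStrategy {F : Measure (Fin n → ℝ)} (h : IsStrategy 0 F) :
    F = Measure.dirac 0 := by
  have := h.isProbabilityMeasure
  have h0 : ∫⁻ x, ENNReal.ofReal (∑ b, x b) ∂F = 0 := by
    simpa using h.budget
  rw [lintegral_eq_zero_iff (by fun_prop)] at h0
  have hae : (fun x => x) =ᵐ[F] fun _ => (0 : Fin n → ℝ) := by
    filter_upwards [h0, h.nonneg] with x hx hnn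
    ext b
    have hs : ∑ b, x b ≤ 0 := by simpa using hx
    exact le_antisymm ((Finset.single_le_sum (fun b _ => hnn b) (Finset.mem_univ b)).trans hs)
      (hnn b)
  have hmap : F.map (fun x => x) = F.map fun _ => 0 := Measure.map_congr hae
  rwa [Measure.map_id', Measure.map_const, measure_univ, one_smul] at hmap

lemma proportional_mem (hw : ∀ b, 0 < w b) (hw1 : ∑ b, w b = 1) (hP : 0 ≤ P) :
    (fun b => P * w b) ∈ preallocations n P :=
  ⟨fun b => mul_nonneg hP (hw b).le, by rw [← Finset.mul_sum, hw1, mul_one]⟩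

/-- The problem reduced to one battlefield of weight `1`, with `x = κA` and `y = κB`. In type 1, `y
= m + P`, so `m` is the positive root `RA + √(RA (RA + 2 P))` of `m² = 2 (m + P) RA`, and the value
is `1 - RB / y`. In type 2, `m = x = 2 (RB - P)` and the value is `RA / x`. -/
lemma spePayoff_eq (hP : 0 ≤ P) (hRA : 0 < RA) (hRB : 0 < RB) {x y m : ℝ} (hx : 0 < x)
    (hy : 0 < y) (hm : m = contested x y P) (hmA : m ^ 2 = 2 * y * RA)
    (hmB : m * (m + 2 * P) = 2 * x * RB) : spePayoff P RA RB = 1 - m / x + RA / x := by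
  have hm2 : 0 < m ^ 2 := by rw [hmA]; positivity
  have hyP : ¬y ≤ P := fun h => by
    rw [hm, contested_of_le hx h] at hm2
    simp at hm2
  rw [spePayoff, if_neg hRA.ne']
  by_cases h : y - P ≤ x
  · rw [contested_of_type1 hyP h] at hm
    have hmpos : 0 < m := by rw [hm]; linarith
    have hym : y = m + P := by linarith
    have h2 : 2 * RA ≤ m := by
      refine le_of_mul_le_mul_left ?_ hmpos
      rw [hym] at hmA
      nlinarith [mul_nonneg hP hRA.le]
    have hS : √(RA * (RA + 2 * P)) = m - RA := by
      have hsq : RA * (RA + 2 * P) = (m - RA) ^ 2 := by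
        rw [hym] at hmA
        linarith
      rw [hsq, Real.sqrt_sq (by linarith)]
    rw [if_pos, hS]
    · rw [show RA + (m - RA) = m by ring, show P + RA + (m - RA) = y by linarith, div_pow, hmA]
      have : (m - RA) / x = RB / y := by
        rw [div_eq_div_iff hx.ne' hy.ne']
        rw [hym] at hmA ⊢
        linarith
      rw [sub_div] at this
      have h3 : RB / (2 * RA) * (2 * y * RA / y ^ 2) = RB / y := by field_simp
      linarith
    -- Type 1 is incompatible with the other branch: `m ≤ x` gives `m ≥ 2 d` with `d = RB - P`,
    -- hence `m² (P + 2 d) ≥ 4 d² (m + P)`, against the assumed threshold.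
    · by_contra! hcon
      obtain ⟨hd, hcon⟩ := hcon
      have hd' : 0 < RB - P := by linarith
      have hz : 2 * (RB - P) ≤ m := by
        have : m * (2 * RB) ≤ m * (m + 2 * P) := by rw [hmB]; nlinarith
        have := le_of_mul_le_mul_left this hmpos
        linarith
      rw [lt_div_iff₀ (by positivity)] at hcon
      set d := RB - P
      have h4 : RA * (P + 2 * d) * (2 * y) < 2 * d ^ 2 * (2 * y) := by gcongr
      have h5 : m ^ 2 * (P + 2 * d) < 4 * d ^ 2 * (m + P) := by
        rw [hmA, ← hym]; linarith
      nlinarith [mul_nonneg hP (mul_nonneg (sub_nonneg.2 hz) (by positivity : 0 ≤ m + 2 * d)),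
        mul_nonneg (mul_pos hd' hmpos).le (sub_nonneg.2 hz)]
  · rw [contested_of_type2 hyP h] at hm
    subst hm
    have h1 : m + 2 * P = 2 * RB := mul_left_cancel₀ hx.ne' (by linarith)
    have hd : 2 * (RB - P) = m := by linarith
    rw [if_neg, hd, div_self hx.ne', sub_self, zero_add]
    push Not
    refine ⟨by linarith, ?_⟩
    rw [hd, lt_div_iff₀ (by positivity)]
    have : RA * (P + m) < RA * y := by gcongr; linarith
    nlinarith

/-- At the pre-allocation `P w` every battlefield is of the same type, and the value of the second
stage is the closed form. -/
lemma IsKappa.proportional (hw : ∀ b, 0 < w b) (hw1 : ∑ b, w b = 1) (hP : 0 ≤ P)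
    (hRA : 0 < RA) (hRB : 0 < RB) {κA κB : ℝ} (h : IsKappa w (fun b => P * w b) RA RB κA κB) :
    ∃ r, 0 ≤ r ∧ r ≤ 1 ∧ r * (P + κA * r / 2) = RB ∧ spePayoff P RA RB = 1 - r + RA / κA ∧
      spePayoff P RA RB = ∑ b, w b * winProbA (w b * κA) (w b * κB) (P * w b) := by
  have hA := h.posA
  have hB := h.posB
  have hα : ∀ b, 0 < w b * κA := fun b => mul_pos (hw b) hA
  set m := contested κA κB P with hm
  -- The contested range is homogeneous of degree one, so at `P w` each battlefield is the unit one
  -- scaled by `w b`.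
  have hcon : ∀ b, contested (w b * κA) (w b * κB) (P * w b) = w b * m := fun b => by
    rw [hm, contested, contested, mul_min_of_nonneg _ _ (hw b).le,
      mul_max_of_nonneg _ _ (hw b).le, mul_zero, mul_sub, mul_comm P]
  have hmA : m ^ 2 = 2 * κB * RA := by
    rw [← h.eqA, Finset.mul_sum]
    calc m ^ 2 = ∑ b, w b * m ^ 2 := by rw [← Finset.sum_mul, hw1, one_mul]
      _ = _ := Finset.sum_congr rfl fun b _ => by
        have := (hw b).ne'
        rw [spendA_eq (hα b), hcon]
        field_simp
  have hmB : m * (m + 2 * P) = 2 * κA * RB := by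
    rw [← h.eqB, Finset.mul_sum]
    calc m * (m + 2 * P) = ∑ b, w b * (m * (m + 2 * P)) := by
          rw [← Finset.sum_mul, hw1, one_mul]
      _ = _ := Finset.sum_congr rfl fun b _ => by
        have := (hw b).ne'
        rw [spendB_eq (hα b), hcon]
        field_simp
  have hval := spePayoff_eq hP hRA hRB hA hB hm hmA hmB
  refine ⟨m / κA, div_nonneg (contested_nonneg hA) hA.le,
    (div_le_one hA).2 contested_le_left, ?_, hval, ?_⟩
  · have : RB = m * (m + 2 * P) / (2 * κA) := by rw [hmB]; field_simp
    rw [this]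
    field_simp
    ring
  · calc spePayoff P RA RB = ∑ b, (w b * (1 - m / κA) + spendA (w b * κA) (w b * κB) (P * w b) / κA)
        := by rw [hval, Finset.sum_add_distrib, ← Finset.sum_mul, hw1, one_mul, ← Finset.sum_div,
          h.eqA]
      _ = _ := Finset.sum_congr rfl fun b _ => by
        have := (hw b).ne'
        rw [winProbA_eq (hα b) (mul_pos (hw b) hB), hcon]
        field_simp

/-- `A` guarantees the closed-form payoff after the proportional pre-allocation. -/
lemma exists_strategyA_proportional (hw : ∀ b, 0 < w b) (hw1 : ∑ b, w b = 1)
    (hτ : ∀ b, 0 ≤ τ b ∧ τ b ≤ 1) (hP : 0 ≤ P) (hRA : 0 ≤ RA) (hRB : 0 < RB) :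
    ∃ FA, IsStrategy RA FA ∧ ∀ FB, IsStrategy RB FB →
      spePayoff P RA RB ≤ payoffA w τ (fun b => P * w b) FA FB := by
  rcases hRA.eq_or_lt with rfl | hRA
  · refine ⟨Measure.dirac 0, isStrategy_dirac_zero 0, fun FB hFB => ?_⟩
    rw [spePayoff, if_pos rfl]
    split_ifs with h
    · have := le_payoffA (τ := τ) (p := fun b => P * w b) (c := 0) (μ := 0)
        (FA := Measure.dirac 0) hw hτ le_rfl hRB.le hFB fun b y hy => by
          simpa using mul_nonneg (hw b).le measureReal_nonneg
      simpa using this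
    · have hPpos : 0 < P := by linarith
      -- The pre-allocation alone beats every `y < P w_b`, which dominates the line `1 - y / (P
      -- w_b)`.
      have := le_payoffA (τ := τ) (p := fun b => P * w b) (c := 1) (μ := 1 / P)
        (FA := Measure.dirac 0) hw hτ (by positivity) hRB.le hFB fun b y hy => by
          have hwb := hw b
          have hms : MeasurableSet {x : Fin n → ℝ | y < x b + P * w b} :=
            measurableSet_lt measurable_const (by fun_prop)
          rw [measureReal_def, Measure.dirac_apply' _ hms, Set.indicator_apply]
          split_ifs with hmem
          · simp only [Pi.one_apply, ENNReal.toReal_one]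
            have : 0 ≤ 1 / P * y := by positivity
            linarith
          · simp only [Set.mem_ofPred_eq, Pi.zero_apply, zero_add, not_lt] at hmem
            have : w b ≤ 1 / P * y := by
              rw [one_div_mul_eq_div, le_div_iff₀ hPpos]; linarith
            simpa using this
      simpa [hw1, div_eq_inv_mul] using this
  · have hp := proportional_mem hw hw1 hP
    obtain ⟨κA, κB, hκ⟩ := exists_isKappa hw hw1 hp.1 hRA hRB
    obtain ⟨-, -, -, -, -, hval⟩ := hκ.proportional hw hw1 hP hRA hRB
    obtain ⟨FA, hFA⟩ := exists_hasMarginalsA hw hp.1 hκ.posA hκ.posB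
    refine ⟨FA, isStrategy_marginalA hw hκ hFA, fun FB hFB => ?_⟩
    rw [hval]
    exact value_le_payoffA hw hτ hRB.le hκ hFA hFB

/-- If `B` can outspend the pre-allocation, an opponent without real-time resources gets nothing. -/
lemma exists_strategyB_of_lt (hw : ∀ b, 0 < w b) (hw1 : ∑ b, w b = 1)
    (hτ : ∀ b, 0 ≤ τ b ∧ τ b ≤ 1) (hPR : P < RB) (hp : p ∈ preallocations n P) :
    ∃ FB, IsStrategy RB FB ∧ ∀ FA, IsStrategy 0 FA → payoffA w τ p FA FB ≤ 0 := by
  -- With `r = 1` the cost is `P + κ / 2`, so this `κ` spends exactly `RB`.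
  obtain ⟨FB, hFB, h⟩ := exists_strategyB (RB := RB) (RA := 0) (r := 1) (κ := 2 * (RB - P))
    hw hw1 hτ hp zero_le_one le_rfl (by linarith) (by linarith) le_rfl
  exact ⟨FB, hFB, fun FA hFA => by simpa using h FA hFA⟩

/-- For every pre-allocation `B` holds `A` down to the closed-form payoff, up to `ε`. -/
lemma exists_strategyB_spePayoff (hw : ∀ b, 0 < w b) (hw1 : ∑ b, w b = 1)
    (hτ : ∀ b, 0 ≤ τ b ∧ τ b ≤ 1) (hP : 0 ≤ P) (hRA : 0 ≤ RA) (hRB : 0 < RB)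
    (hp : p ∈ preallocations n P) {ε : ℝ} (hε : 0 < ε) :
    ∃ FB, IsStrategy RB FB ∧ ∀ FA, IsStrategy RA FA →
      payoffA w τ p FA FB ≤ spePayoff P RA RB + ε := by
  rcases hRA.eq_or_lt with rfl | hRA
  · rcases lt_or_ge P RB with hPR | hPR
    · obtain ⟨FB, hFB, h⟩ := exists_strategyB_of_lt hw hw1 hτ hPR hp
      refine ⟨FB, hFB, fun FA hFA => (h FA hFA).trans ?_⟩
      rw [spePayoff, if_pos rfl, if_pos hPR.le]
      linarith
    · have hPpos : 0 < P := hRB.trans_le hPR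
      have hval : spePayoff P 0 RB = 1 - RB / P := by
        rw [spePayoff, if_pos rfl]
        split_ifs with h
        · rw [le_antisymm h hPR, div_self hRB.ne', sub_self]
        · rfl
      set s := RB / P with hs
      have hs0 : 0 < s := by positivity
      have hs1 : s ≤ 1 := (div_le_one hPpos).2 hPR
      have hr0 : 0 < s / (1 + ε) := by positivity
      have hr1 : s / (1 + ε) ≤ 1 := by rw [div_le_one (by positivity)]; linarith
      -- Exceeding `p b` costs slightly more than `p b`: a ramp of width `O(ε)` is paid for by
      -- lowering the contesting probability from `s` to `s / (1 + ε)`.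
      obtain ⟨FB, hFB, h⟩ := exists_strategyB (RB := RB) (RA := 0) (r := s / (1 + ε))
        (κ := ε * P) hw hw1 hτ hp hr0.le hr1 (by positivity) (by
          calc s / (1 + ε) * (P + ε * P * (s / (1 + ε)) / 2) ≤ s / (1 + ε) * (P + ε * P) := by
                refine mul_le_mul_of_nonneg_left ?_ hr0.le
                have : 0 < ε * P := by positivity
                nlinarith
            _ = RB := by rw [hs]; field_simp) le_rfl
      refine ⟨FB, hFB, fun FA hFA => (h FA hFA).trans ?_⟩
      have : s ≤ s / (1 + ε) + ε := by
        have h1 : s = s / (1 + ε) + s / (1 + ε) * ε := by field_simp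
        nlinarith
      rw [hval, zero_div]
      linarith
  -- `r` and `κA` come from the proportional pre-allocation but are used against the arbitrary `p`;
  -- cost and cap are unchanged because the entries of `p` also sum to `P`.
  · obtain ⟨κA, κB, hκ⟩ := exists_isKappa hw hw1 (proportional_mem hw hw1 hP).1 hRA hRB
    obtain ⟨r, hr0, hr1, hcost, hval, -⟩ := hκ.proportional hw hw1 hP hRA hRB
    obtain ⟨FB, hFB, h⟩ := exists_strategyB hw hw1 hτ hp hr0 hr1 hκ.posA hcost.le hRA.le
    refine ⟨FB, hFB, fun FA hFA => (h FA hFA).trans ?_⟩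
    rw [hval]
    linarith

end guarantees

/-! ### Second-stage equilibria when `A` has no real-time resources -/

section noResources

variable {w τ p : Fin n → ℝ} {RB : ℝ}

lemma payoffA_nonneg (hw : ∀ b, 0 < w b) (hτ : ∀ b, 0 ≤ τ b) (FA FB : Measure (Fin n → ℝ)) :
    0 ≤ payoffA w τ p FA FB :=
  integral_nonneg fun _ => Finset.sum_nonneg fun b _ =>
    mul_nonneg (hw b).le (winShare_nonneg (hτ b))

/-- With zero budget the only strategy of `A` is the point mass at `0`, so equilibrium is just a
best reply of `B`. -/
lemma isNash_of_forall_payoffA_le {FB : Measure (Fin n → ℝ)} (hFB : IsStrategy RB FB)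
    (h : ∀ GB, IsStrategy RB GB →
      payoffA w τ p (Measure.dirac 0) FB ≤ payoffA w τ p (Measure.dirac 0) GB) :
    IsNash w τ p 0 RB (Measure.dirac 0) FB := by
  refine ⟨isStrategy_dirac_zero 0, hFB, fun GA hGA => ?_, fun GB hGB => ?_⟩
  · rw [eq_dirac_zero_of_isStrategy hGA]
  · exact sub_le_sub_left (h GB hGB) 1

lemma payoffA_dirac_zero {w τ : Fin n → ℝ} (hτ : ∀ b, τ b = 0) (FB : Measure (Fin n → ℝ))
    [IsProbabilityMeasure FB] :
    payoffA w τ p (Measure.dirac 0) FB = ∑ b, w b * (1 - FB.real {y | p b ≤ y b}) := by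
  have hms : ∀ b, MeasurableSet {y : Fin n → ℝ | p b ≤ y b} := fun b =>
    measurableSet_le measurable_const (by fun_prop)
  have hmeas := (measurable_share w τ p).stronglyMeasurable
  rw [payoffA, Measure.dirac_prod, integral_map measurable_prodMk_left.aemeasurable
    hmeas.aestronglyMeasurable]
  have he : ∀ (b : Fin n) (y : Fin n → ℝ), winShare (τ b) ((0 : Fin n → ℝ) b + p b) (y b) =
      Set.indicator {y : Fin n → ℝ | p b ≤ y b}ᶜ 1 y := fun b y => by
    simp only [winShare, hτ b, Pi.zero_apply, zero_add, ite_self, Set.indicator_apply,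
      Set.mem_compl_iff, Set.mem_ofPred_eq, not_le, Pi.one_apply]
  simp only [he]
  rw [integral_finsetSum]
  · refine Finset.sum_congr rfl fun b _ => ?_
    rw [integral_const_mul, integral_indicator_one (hms b).compl,
      probReal_compl_eq_one_sub (hms b)]
  · intro b _
    exact ((integrable_const (1 : ℝ)).indicator (hms b).compl).const_mul _

/-- Markov's inequality summed over battlefields: it makes the winning probabilities of `B` feasible
for the knapsack problem. -/
lemma IsStrategy.sum_mul_real_le (hRB : 0 ≤ RB) {F : Measure (Fin n → ℝ)}
    (h : IsStrategy RB F) : ∑ b, p b * F.real {y | p b ≤ y b} ≤ RB := by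
  have := h.isProbabilityMeasure
  have hms : ∀ b, MeasurableSet {y : Fin n → ℝ | p b ≤ y b} := fun b =>
    measurableSet_le measurable_const (by fun_prop)
  refine le_trans ?_ (h.integral_le hRB)
  calc ∑ b, p b * F.real {y | p b ≤ y b}
      = ∫ y, ∑ b, Set.indicator {y : Fin n → ℝ | p b ≤ y b} (fun _ => p b) y ∂F := by
        rw [integral_finsetSum _ fun b _ => (integrable_const (p b)).indicator (hms b)]
        refine Finset.sum_congr rfl fun b _ => ?_
        rw [integral_indicator_const _ (hms b), smul_eq_mul, mul_comm]
    _ ≤ ∫ y, ∑ b, y b ∂F := by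
        refine integral_mono_ae
          (integrable_finsetSum _ fun b _ => (integrable_const (p b)).indicator (hms b))
          h.integrable ?_
        filter_upwards [h.nonneg] with y hy
        refine Finset.sum_le_sum fun b _ => ?_
        rw [Set.indicator_apply]
        split_ifs with hb
        · exact hb
        · exact hy b

/-- A distribution that puts `p b` on battlefield `b` with probability `r b`, and `0` otherwise. -/
lemma exists_twoPoint (hp : ∀ b, 0 ≤ p b) {r : Fin n → ℝ} (hr : ∀ b, 0 ≤ r b ∧ r b ≤ 1)
    (hcost : ∑ b, p b * r b ≤ RB) :
    ∃ F, IsStrategy RB F ∧ ∀ b, r b ≤ F.real {y | p b ≤ y b} := by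
  let μ : Measure ℝ := volume.restrict (Set.Ioc 0 1)
  have hμ : IsProbabilityMeasure μ := ⟨by simp [μ]⟩
  -- A single uniform variable `u` drives all battlefields; only the marginals matter. The
  -- probability claimed is `≥` rather than `=` because the event is certain where `p b = 0`.
  let f : ℝ → Fin n → ℝ := fun u b => if u ≤ r b then p b else 0
  have hf : Measurable f := measurable_pi_lambda _ fun b =>
    Measurable.ite measurableSet_Iic measurable_const measurable_const
  have hnn : ∀ u b, 0 ≤ f u b := fun u b => by
    simp only [f]; split_ifs; exacts [hp b, le_rfl]
  have hIic : ∀ b, μ (Set.Iic (r b)) = ENNReal.ofReal (r b) := fun b => by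
    rw [Measure.restrict_apply measurableSet_Iic, Set.inter_comm, Set.Ioc_inter_Iic,
      min_eq_right (hr b).2, Real.volume_Ioc, sub_zero]
  have hprob : IsProbabilityMeasure (μ.map f) := Measure.isProbabilityMeasure_map hf.aemeasurable
  have hnn' : ∀ᵐ x ∂μ.map f, ∀ b, 0 ≤ x b := by
    rw [ae_map_iff hf.aemeasurable]
    · exact Filter.Eventually.of_forall hnn
    · simp only [Set.ofPred_forall]
      exact MeasurableSet.iInter fun b => measurableSet_le measurable_const (by fun_prop)
  refine ⟨μ.map f, ⟨hprob, hnn', ?_⟩, fun b => ?_⟩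
  · rw [lintegral_sum_coord hnn']
    refine le_trans (le_of_eq ?_) (ENNReal.ofReal_le_ofReal hcost)
    rw [ENNReal.ofReal_sum_of_nonneg fun b _ => mul_nonneg (hp b) (hr b).1]
    refine Finset.sum_congr rfl fun b _ => ?_
    rw [lintegral_map (by fun_prop) hf, ENNReal.ofReal_mul (hp b), ← hIic b,
      ← lintegral_indicator_const measurableSet_Iic]
    refine lintegral_congr fun u => ?_
    simp only [f, Set.indicator_apply, Set.mem_Iic]
    split_ifs <;> simp
  · have hms : MeasurableSet {y : Fin n → ℝ | p b ≤ y b} :=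
      measurableSet_le measurable_const (by fun_prop)
    rw [map_measureReal_apply hf hms]
    have h1 : μ.real (Set.Iic (r b)) = r b := by
      rw [measureReal_def, hIic, ENNReal.toReal_ofReal (hr b).1]
    rw [← h1]
    refine measureReal_mono fun u hu => ?_
    simp only [Set.mem_preimage, Set.mem_ofPred_eq, f]
    rw [if_pos (Set.mem_Iic.1 hu)]

/-- If ties go to `B`, best replies of `B` to `x_A = 0` solve a fractional knapsack problem. -/
lemma exists_isNash_zero (hw : ∀ b, 0 < w b) (hτ : ∀ b, τ b = 0) (hp : ∀ b, 0 ≤ p b)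
    (hRB : 0 ≤ RB) : ∃ FB, IsNash w τ p 0 RB (Measure.dirac 0) FB := by
  let K : Set (Fin n → ℝ) := Set.Icc 0 1 ∩ {r | ∑ b, p b * r b ≤ RB}
  have hK : IsCompact K :=
    isCompact_Icc.inter_right (isClosed_le (by fun_prop) continuous_const)
  have hne : K.Nonempty := ⟨0, ⟨le_rfl, zero_le_one⟩, by simpa using hRB⟩
  obtain ⟨r, hr, hmax⟩ := hK.exists_isMaxOn (f := fun r => ∑ b, w b * r b) hne (by fun_prop)
  obtain ⟨FB, hFB, hge⟩ := exists_twoPoint hp (fun b => ⟨hr.1.1 b, hr.1.2 b⟩) hr.2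
  have := hFB.isProbabilityMeasure
  refine ⟨FB, isNash_of_forall_payoffA_le hFB fun GB hGB => ?_⟩
  have := hGB.isProbabilityMeasure
  rw [payoffA_dirac_zero hτ, payoffA_dirac_zero hτ]
  have hmem : (fun b => GB.real {y | p b ≤ y b}) ∈ K :=
    ⟨⟨fun b => measureReal_nonneg, fun b => measureReal_le_one⟩, hGB.sum_mul_real_le hRB⟩
  have h1 : ∑ b, w b * GB.real {y | p b ≤ y b} ≤ ∑ b, w b * r b := hmax hmem
  have h2 : ∑ b, w b * r b ≤ ∑ b, w b * FB.real {y | p b ≤ y b} :=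
    Finset.sum_le_sum fun b _ => mul_le_mul_of_nonneg_left (hge b) (hw b).le
  simp only [mul_sub, Finset.sum_sub_distrib]
  linarith

end noResources

/-! ### Subgame-perfect equilibria -/

section twoStage

variable {w τ : Fin n → ℝ} {P RA RB : ℝ}

/-- When `RA = 0`, `RB ≤ P` and ties may favour `A`, the infimum that `B` can approach need not be
attained; the disjunction excludes this. -/
lemma exists_isNash (hw : ∀ b, 0 < w b) (hw1 : ∑ b, w b = 1) (hτ : ∀ b, 0 ≤ τ b ∧ τ b ≤ 1)
    (hRA : 0 ≤ RA) (hRB : 0 < RB) (h : 0 < RA ∨ P < RB ∨ ∀ b, τ b = 0) {p : Fin n → ℝ}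
    (hp : p ∈ preallocations n P) : ∃ FA FB, IsNash w τ p RA RB FA FB := by
  rcases hRA.eq_or_lt with rfl | hRA
  · rcases h with h | h | h
    · exact absurd h (lt_irrefl 0)
    · obtain ⟨FB, hFB, hle⟩ := exists_strategyB_of_lt hw hw1 hτ h hp
      exact ⟨Measure.dirac 0, FB, isNash_of_forall_payoffA_le hFB fun GB _ =>
        (hle _ (isStrategy_dirac_zero 0)).trans (payoffA_nonneg hw (fun b => (hτ b).1) _ _)⟩
    · exact ⟨_, exists_isNash_zero hw h hp.1 hRB.le⟩
  · obtain ⟨κA, κB, hκ⟩ := exists_isKappa hw hw1 hp.1 hRA hRB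
    obtain ⟨FA, hFA⟩ := exists_hasMarginalsA hw hp.1 hκ.posA hκ.posB
    obtain ⟨FB, hFB⟩ := exists_hasMarginalsB (κB := κB) (p := p) hw hκ.posA
    exact ⟨FA, FB, isNash_of_marginals hw hτ hp.1 hRA.le hRB.le hκ hFA hFB⟩

lemma IsNash.spePayoff_le (hw : ∀ b, 0 < w b) (hw1 : ∑ b, w b = 1)
    (hτ : ∀ b, 0 ≤ τ b ∧ τ b ≤ 1) (hP : 0 ≤ P) (hRA : 0 ≤ RA) (hRB : 0 < RB)
    {FA FB : Measure (Fin n → ℝ)} (h : IsNash w τ (fun b => P * w b) RA RB FA FB) :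
    spePayoff P RA RB ≤ payoffA w τ (fun b => P * w b) FA FB :=
  h.le_payoffA_of_guarantee (exists_strategyA_proportional hw hw1 hτ hP hRA hRB)

lemma IsNash.payoffA_le_spePayoff (hw : ∀ b, 0 < w b) (hw1 : ∑ b, w b = 1)
    (hτ : ∀ b, 0 ≤ τ b ∧ τ b ≤ 1) (hP : 0 ≤ P) (hRA : 0 ≤ RA) (hRB : 0 < RB) {p : Fin n → ℝ}
    (hp : p ∈ preallocations n P) {FA FB : Measure (Fin n → ℝ)}
    (h : IsNash w τ p RA RB FA FB) : payoffA w τ p FA FB ≤ spePayoff P RA RB :=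
  le_of_forall_pos_le_add fun _ hε =>
    h.payoffA_le_of_guarantee (exists_strategyB_spePayoff hw hw1 hτ hP hRA hRB hp hε)

lemma isSPE_proportional (hw : ∀ b, 0 < w b) (hw1 : ∑ b, w b = 1)
    (hτ : ∀ b, 0 ≤ τ b ∧ τ b ≤ 1) (hP : 0 ≤ P) (hRA : 0 ≤ RA) (hRB : 0 < RB)
    {FA FB : (Fin n → ℝ) → Measure (Fin n → ℝ)}
    (h : ∀ p ∈ preallocations n P, IsNash w τ p RA RB (FA p) (FB p)) :
    IsSPE w τ P RA RB (fun b => P * w b) FA FB :=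
  have hp := proportional_mem hw hw1 hP
  ⟨hp, h, fun p hp' => ((h p hp').payoffA_le_spePayoff hw hw1 hτ hP hRA hRB hp').trans
    ((h _ hp).spePayoff_le hw hw1 hτ hP hRA hRB)⟩

/-- The cap holds at `pstar` itself. The lower bound is imported from `P w`, to which `A` could have
deviated in the first stage. -/
lemma IsSPE.payoffA_eq (hw : ∀ b, 0 < w b) (hw1 : ∑ b, w b = 1)
    (hτ : ∀ b, 0 ≤ τ b ∧ τ b ≤ 1) (hP : 0 ≤ P) (hRA : 0 ≤ RA) (hRB : 0 < RB)
    {pstar : Fin n → ℝ} {FA FB : (Fin n → ℝ) → Measure (Fin n → ℝ)}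
    (h : IsSPE w τ P RA RB pstar FA FB) :
    payoffA w τ pstar (FA pstar) (FB pstar) = spePayoff P RA RB :=
  have hp := proportional_mem hw hw1 hP
  le_antisymm
    ((h.nash _ h.feasible).payoffA_le_spePayoff hw hw1 hτ hP hRA hRB h.feasible)
    (((h.nash _ hp).spePayoff_le hw hw1 hτ hP hRA hRB).trans (h.optimal _ hp))

lemma exists_isSPE (hw : ∀ b, 0 < w b) (hw1 : ∑ b, w b = 1) (hτ : ∀ b, 0 ≤ τ b ∧ τ b ≤ 1)
    (hP : 0 ≤ P) (hRA : 0 ≤ RA) (hRB : 0 < RB) (h : 0 < RA ∨ P < RB ∨ ∀ b, τ b = 0) :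
    ∃ FA FB, IsSPE w τ P RA RB (fun b => P * w b) FA FB := by
  have hex : ∀ p : Fin n → ℝ, ∃ FA FB, p ∈ preallocations n P → IsNash w τ p RA RB FA FB := by
    intro p
    by_cases hp : p ∈ preallocations n P
    · obtain ⟨FA, FB, hN⟩ := exists_isNash hw hw1 hτ hRA hRB h hp
      exact ⟨FA, FB, fun _ => hN⟩
    · exact ⟨0, 0, fun hp' => absurd hp' hp⟩
  choose FA FB hN using hex
  exact ⟨FA, FB, isSPE_proportional hw hw1 hτ hP hRA hRB hN⟩

end twoStage

end Lotto

end

/-! ### Both stages assembled -/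

theorem mainTheorem1 {n : ℕ} (w : Fin n → ℝ) (hw : ∀ b, 0 < w b) (hw1 : ∑ b, w b = 1)
    (τ : Fin n → ℝ) (hτ : ∀ b, 0 ≤ τ b ∧ τ b ≤ 1) (RB : ℝ) (hRB : 0 < RB) :
    -- the second stage, for an arbitrary nonnegative pre-allocation vector
    (∀ RA : ℝ, 0 < RA → ∀ p : Fin n → ℝ, (∀ b, 0 ≤ p b) →
      (∃ κA κB, Lotto.IsKappa w p RA RB κA κB) ∧
      ∀ κA κB, Lotto.IsKappa w p RA RB κA κB →
        (κA = Lotto.kappaA w p RA RB (Lotto.type1 w p κA κB) (Lotto.type2 w p κA κB) ∧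
          κB = Lotto.kappaB w p RA RB (Lotto.type1 w p κA κB) (Lotto.type2 w p κA κB)) ∧
        (∃ FA, Lotto.HasMarginals FA
          (fun b => Lotto.marginalA (w b * κA) (w b * κB) (p b))) ∧
        (∃ FB, Lotto.HasMarginals FB
          (fun b => Lotto.marginalB (w b * κA) (w b * κB) (p b))) ∧
        (∀ FA FB,
          Lotto.HasMarginals FA (fun b => Lotto.marginalA (w b * κA) (w b * κB) (p b)) →
          Lotto.HasMarginals FB (fun b => Lotto.marginalB (w b * κA) (w b * κB) (p b)) →
          Lotto.IsNash w τ p RA RB FA FB) ∧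
        (∀ FA FB, Lotto.IsNash w τ p RA RB FA FB →
          Lotto.payoffA w τ p FA FB =
            ∑ b, w b * Lotto.winProbA (w b * κA) (w b * κB) (p b))) ∧
    -- the two-stage game
    (∀ P RA : ℝ, 0 ≤ P → 0 ≤ RA →
      ((0 < RA ∨ P < RB ∨ ∀ b, τ b = 0) →
        ∃ FA FB, Lotto.IsSPE w τ P RA RB (fun b => P * w b) FA FB) ∧
      (∀ FA FB : (Fin n → ℝ) → MeasureTheory.Measure (Fin n → ℝ),
        (∀ p ∈ Lotto.preallocations n P, Lotto.IsNash w τ p RA RB (FA p) (FB p)) →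
        Lotto.IsSPE w τ P RA RB (fun b => P * w b) FA FB) ∧
      (∀ pstar FA FB, Lotto.IsSPE w τ P RA RB pstar FA FB →
        Lotto.payoffA w τ pstar (FA pstar) (FB pstar) = Lotto.spePayoff P RA RB ∧
        Lotto.payoffB w τ pstar (FA pstar) (FB pstar) = 1 - Lotto.spePayoff P RA RB) ∧
      (∃ FA, Lotto.IsStrategy RA FA ∧ ∀ FB, Lotto.IsStrategy RB FB →
        Lotto.spePayoff P RA RB ≤ Lotto.payoffA w τ (fun b => P * w b) FA FB) ∧
      (∀ p ∈ Lotto.preallocations n P, ∀ ε : ℝ, 0 < ε →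
        ∃ FB, Lotto.IsStrategy RB FB ∧ ∀ FA, Lotto.IsStrategy RA FA →
          Lotto.payoffA w τ p FA FB ≤ Lotto.spePayoff P RA RB + ε)) := by
  refine ⟨fun RA hRA p hp => ⟨Lotto.exists_isKappa hw hw1 hp hRA hRB, fun κA κB hκ =>
    ⟨hκ.eq_closed_form hw hp hRA hRB, Lotto.exists_hasMarginalsA hw hp hκ.posA hκ.posB,
      Lotto.exists_hasMarginalsB hw hκ.posA, fun FA FB hFA hFB =>
        Lotto.isNash_of_marginals hw hτ hp hRA.le hRB.le hκ hFA hFB, fun FA FB h =>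
        h.payoffA_eq hw hτ hp hRA.le hRB.le hκ⟩⟩, fun P RA hP hRA => ⟨?_, ?_, ?_, ?_, ?_⟩⟩
  · exact Lotto.exists_isSPE hw hw1 hτ hP hRA hRB
  · exact fun FA FB h => Lotto.isSPE_proportional hw hw1 hτ hP hRA hRB h
  · intro pstar FA FB h
    have hA := h.payoffA_eq hw hw1 hτ hP hRA hRB
    exact ⟨hA, by rw [Lotto.payoffB, hA]⟩
  · exact Lotto.exists_strategyA_proportional hw hw1 hτ hP hRA hRB
  · exact fun p hp ε hε => Lotto.exists_strategyB_spePayoff hw hw1 hτ hP hRA hRB hp hε
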